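/- Let $H$ be a complex Hilbert space with inner product $(\cdot,\cdot)$, linear in the first argument. Operators in $H$ are linear maps defined on subspaces; sums and products of operators have their natural domains, and $\mathrm{dom}$, $\mathrm{ran}$ denote domain and range. An operator $A$ is *$m$-accretive* if it is densely defined, $\mathrm{Re}(Au,u)\ge 0$ for all $u\in\mathrm{dom}\,A$, and $\mathrm{ran}(A-\lambda I)=H$ for some $\lambda$ with $\mathrm{Re}\,\lambda<0$. It is *$m$-sectorial* if in addition, for some $\alpha\in[0,\pi/2)$, $|\mathrm{Im}(Au,u)|\le\tan\alpha\,\mathrm{Re}(Au,u)$ for all $u\in\mathrm{dom}\,A$. For $m$-accretive $A$ let $A^{1/2}$ be its $m$-accretive square root, i.e. $A^{1/2}=(I-T)^{1/2}\big((I+T)^{1/2}\big)^{-1}$ with the contraction $T=(I-A)(I+A)^{-1}$ and $(I\pm T)^{1/2}=\sum_{n\ge0}\binom{1/2}{n}(\pm T)^n$. For a bounded operator $T$ on $H$ put $\mathrm{Re}\,T=\frac12(T+T^*)$ and $\mathrm{Im}\,T=\frac1{2i}(T-T^*)$. "Bounded inverse" means a bounded inverse defined on all of $H$. Let $B$ be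 an unbounded $m$-accretive operator in $H$ having bounded inverse. Write $B^{-1/2}=(B^{1/2})^{-1}$, $B^{*1/2}=(B^*)^{1/2}$, $B^{*-1/2}=(B^{*1/2})^{-1}$, and let $$Z=i\,\big(\mathrm{Re}\,B^{-1/2}\big)^{-1}\,\mathrm{Im}\,B^{-1/2}.$$ **(1)** The following are equivalent: - (i) $\mathrm{dom}\,B^{1/2}=\mathrm{dom}\,B^{*1/2}$; - (ii) the operator $B^{1/2}B^{*-1/2}$ is bounded and has bounded inverse; - (iii) $\mathrm{ran}(I+Z)=\mathrm{ran}(I-Z)=H$; - (iv) $\mathrm{ran}(I-Z^2)=H$; - (v) $\mathrm{dom}\,(\mathrm{Re}\,B^{-1/2})^{-1}\subseteq\mathrm{dom}\,B^{1/2}\cap\mathrm{dom}\,B^{*1/2}$. **(2)** Suppose moreover that $B$ is $m$-sectorial. Let $\mathfrak b$ be the closed sectorial form associated with $B$, i.e. the closed sectorial form which has $\mathrm{dom}\,B$ as a core and satisfies $\mathfrak b[u,v]=(Bu,v)$ for $u\in\mathrm{dom}\,B$, $v\in\mathrm{dom}\,\mathfrak b$. Let $B_R$ be the nonnegative selfadjoint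 operator associated with the form $\mathfrak b_R[u,v]=\frac12\big(\mathfrak b[u,v]+\overline{\mathfrak b[v,u]}\big)$: $u\in\mathrm{dom}\,B_R$ and $B_Ru=w$ if and only if $u\in\mathrm{dom}\,\mathfrak b$ and $\mathfrak b_R[u,v]=(w,v)$ for all $v\in\mathrm{dom}\,\mathfrak b$. Then the following are equivalent: - (a) $\mathrm{dom}\,B^{1/2}=\mathrm{dom}\,B^{*1/2}$; - (b) $\mathrm{dom}\,B^{1/2}=\mathrm{dom}\,B_R^{1/2}$; - (c) $\mathrm{dom}\,B^{*1/2}=\mathrm{dom}\,B_R^{1/2}$; - (d) $\mathrm{dom}\,B^{1/2}\subseteq\mathrm{dom}\,B_R^{1/2}$ and $\mathrm{dom}\,B^{*1/2}\subseteq\mathrm{dom}\,B_R^{1/2}$; - (e) $\mathrm{dom}\,B_R^{1/2}\subseteq\mathrm{dom}\,B^{1/2}\cap\mathrm{dom}\,B^{*1/2}$; - (f) $\|Z\|<1$; - (g) $\displaystyle\sup_{f\in H\setminus\{0\}}\frac{\|(\mathrm{Re}\,B^{-1/2})f\|^2}{\mathrm{Re}(B^{-1}f,f)}<\infty$; - (h)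 $\displaystyle\sup_{f\in H\setminus\{0\}}\frac{\|B^{*-1/2}f\|^2+\|B^{-1/2}f\|^2}{\mathrm{Re}(B^{-1}f,f)}<\infty$; - (i) $\mathrm{dom}\,(\mathrm{Re}\,B^{-1/2})^{-1}=\mathrm{dom}\,\big((\mathrm{Re}\,B^{-1})^{1/2}\big)^{-1}$, with the nonnegative square root of the bounded nonnegative operator $\mathrm{Re}\,B^{-1}$. -/

import Mathlib

noncomputable section

namespace KatoSquareRoot

variable {H : Type*} [NormedAddCommGroup H] [InnerProductSpace ℂ H]

/-! ### Unbounded operators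

A linear operator in `H` is a `LinearPMap`, that is, a linear map defined on a subspace of `H`.
The inner product `(x, y)` that is linear in `x` is `inner ℂ y x` in Mathlib. -/

/-- An everywhere defined bounded operator, seen as an operator with domain `H`. -/
def ofBounded (T : H →L[ℂ] H) : H →ₗ.[ℂ] H := T.toLinearMap.toPMap ⊤

/-- The identity operator. -/
def idOp : H →ₗ.[ℂ] H := ofBounded (ContinuousLinearMap.id ℂ H)

/-- The product `S T` of two operators, on its natural domain
`{x ∈ dom T : T x ∈ dom S}`. -/
def opMul (S T : H →ₗ.[ℂ] H) : H →ₗ.[ℂ] H where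
  domain := (S.domain.comap T.toFun).map T.domain.subtype
  toFun :=
    { toFun := fun x => S ⟨T ⟨x, by
          obtain ⟨y, _, hy⟩ := x.2; exact hy ▸ y.2⟩, by
          obtain ⟨x, y, hm, rfl⟩ := x; exact hm⟩
      map_add' := fun x y => by
        rw [← LinearPMap.map_add]; congr 1
        ext; simp only [Submodule.coe_add]; rw [← LinearPMap.map_add]; rfl
      map_smul' := fun c x => by
        rw [RingHom.id_apply, ← LinearPMap.map_smul]; congr 1
        ext; simp only [Submodule.coe_smul]; rw [← LinearPMap.map_smul]; rfl }

/-- The range of an operator. -/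
def ran (A : H →ₗ.[ℂ] H) : Submodule ℂ H := LinearMap.range A.toFun

/-- The norm `sup {‖A x‖ : x ∈ dom A, ‖x‖ ≤ 1}` of an operator, as an element of `[0, ∞]`. -/
def opNorm (A : H →ₗ.[ℂ] H) : ENNReal := ⨆ (x : A.domain) (_ : ‖x‖ ≤ 1), ‖A x‖ₑ

/-- An operator is bounded if its norm is finite. -/
def IsBoundedOp (A : H →ₗ.[ℂ] H) : Prop := opNorm A < ⊤

/-- The bounded operator `S`, defined on the whole space, is the inverse of the operator `A`. -/
def IsBoundedInverse (A : H →ₗ.[ℂ] H) (S : H →L[ℂ] H) : Prop :=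
  (∀ y : H, (S y, y) ∈ A.graph) ∧ ∀ x : A.domain, S (A x) = x

/-- `A` has a bounded inverse, defined on the whole space. -/
def HasBoundedInverse (A : H →ₗ.[ℂ] H) : Prop := ∃ S : H →L[ℂ] H, IsBoundedInverse A S

open Classical in
/-- The bounded operator `A⁻¹` (with the default value `0` if `A` has no bounded inverse). -/
def boundedInv (A : H →ₗ.[ℂ] H) : H →L[ℂ] H :=
  if h : HasBoundedInverse A then h.choose else 0

/-! ### Accretive and sectorial operators -/

/-- `Re (A u, u) ≥ 0` for all `u ∈ dom A`. -/
def IsAccretive (A : H →ₗ.[ℂ] H) : Prop :=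
  ∀ u : A.domain, 0 ≤ (inner ℂ (u : H) (A u)).re

/-- `A` is `m`-accretive: it is accretive, densely defined, and `ran (A - λ I) = H` for some
`λ` with `Re λ < 0`. -/
def IsMAccretive (A : H →ₗ.[ℂ] H) : Prop :=
  IsAccretive A ∧ Dense (A.domain : Set H) ∧
    ∃ l : ℂ, l.re < 0 ∧ ran (A - l • idOp) = ⊤

/-- `A` is `m`-`α`-sectorial for some semi-angle `α ∈ [0, π/2)`. -/
def IsMSectorial (A : H →ₗ.[ℂ] H) : Prop :=
  IsMAccretive A ∧ ∃ α : ℝ, 0 ≤ α ∧ α < Real.pi / 2 ∧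
    ∀ u : A.domain, |(inner ℂ (u : H) (A u)).im| ≤ Real.tan α * (inner ℂ (u : H) (A u)).re

/-! ### The square root of an `m`-accretive operator -/

/-- The Cayley transform `T = (I - A)(I + A)⁻¹ = 2 (I + A)⁻¹ - I`, which is a contraction if
`A` is `m`-accretive. -/
def cayley (A : H →ₗ.[ℂ] H) : H →L[ℂ] H :=
  (2 : ℂ) • boundedInv (idOp + A) - ContinuousLinearMap.id ℂ H

/-- The square root `(I + T)^(1/2)`, for a contraction `T`, given by the binomial series
`∑ n, (1/2 choose n) T ^ n`, which converges absolutely in the operator norm. -/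
def sqrtOneAdd (T : H →L[ℂ] H) : H →L[ℂ] H := ∑' n : ℕ, Ring.choose (1 / 2 : ℝ) n • T ^ n

/-- The square root `A^(1/2) = (I - T)^(1/2) ((I + T)^(1/2))⁻¹` of an `m`-accretive operator `A`,
where `T` is the Cayley transform of `A`. It is the unique `m`-accretive operator with
square `A`. -/
def sqrtOp (A : H →ₗ.[ℂ] H) : H →ₗ.[ℂ] H :=
  opMul (ofBounded (sqrtOneAdd (-cayley A))) (ofBounded (sqrtOneAdd (cayley A))).inverse

/-! ### Sesquilinear forms -/

/-- A sesquilinear form `a[u, v]` on a subspace of `H`, linear in `u` and antilinear in `v`. -/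
structure SesqForm (H : Type*) [NormedAddCommGroup H] [InnerProductSpace ℂ H] where
  domain : Submodule ℂ H
  form : domain →ₗ[ℂ] domain →ₗ⋆[ℂ] ℂ

namespace SesqForm

/-- `a` is sectorial, with vertex `0` and some semi-angle `α ∈ [0, π/2)`. -/
def IsSectorial (a : SesqForm H) : Prop :=
  ∃ α : ℝ, 0 ≤ α ∧ α < Real.pi / 2 ∧ ∀ u : a.domain,
    0 ≤ (a.form u u).re ∧ |(a.form u u).im| ≤ Real.tan α * (a.form u u).re

/-- `a` is closed: if `u n ∈ dom a`, `u n → u` in `H` and `a[u n - u m, u n - u m] → 0`, then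
`u ∈ dom a` and `a[u n - u, u n - u] → 0`. -/
def IsClosed (a : SesqForm H) : Prop :=
  ∀ (x : ℕ → a.domain) (u : H),
    Filter.Tendsto (fun n => (x n : H)) Filter.atTop (nhds u) →
    Filter.Tendsto (fun p : ℕ × ℕ => a.form (x p.1 - x p.2) (x p.1 - x p.2))
      Filter.atTop (nhds 0) →
    ∃ hu : u ∈ a.domain,
      Filter.Tendsto (fun n => a.form (x n - ⟨u, hu⟩) (x n - ⟨u, hu⟩)) Filter.atTop (nhds 0)

/-- The real part `a_R[u, v] = (a[u, v] + conj a[v, u]) / 2`. -/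
def realPart (a : SesqForm H) : SesqForm H where
  domain := a.domain
  form := LinearMap.mk₂'ₛₗ (RingHom.id ℂ) (starRingEnd ℂ)
    (fun u v => (1 / 2 : ℂ) * (a.form u v + starRingEnd ℂ (a.form v u)))
    (fun u u' v => by simp only [map_add, LinearMap.add_apply]; ring)
    (fun c u v => by
      simp only [map_smul, map_smulₛₗ, LinearMap.smul_apply, smul_eq_mul, map_mul,
        Complex.conj_conj, RingHom.id_apply]; ring)
    (fun u v v' => by simp only [map_add, LinearMap.add_apply]; ring)
    (fun c u v => by
      simp only [map_smul, map_smulₛₗ, LinearMap.smul_apply, smul_eq_mul, map_mul]; ring)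

/-- The graph of the operator associated with `a`: all pairs `(u, w)` with `u ∈ dom a` and
`a[u, v] = (w, v)` for all `v ∈ dom a`. -/
def operatorGraph (a : SesqForm H) : Submodule ℂ (H × H) where
  carrier := {p | ∃ u : a.domain, (u : H) = p.1 ∧ ∀ v : a.domain, a.form u v = inner ℂ (v : H) p.2}
  add_mem' := by
    rintro p q ⟨u, hu, h⟩ ⟨u', hu', h'⟩
    exact ⟨u + u', by simp [hu, hu'], fun v => by simp [h, h']⟩
  zero_mem' := ⟨0, by simp, fun v => by simp⟩
  smul_mem' := by
    rintro c p ⟨u, hu, h⟩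
    exact ⟨c • u, by simp [hu], fun v => by simp [h]⟩

/-- The operator associated with a densely defined form `a`. -/
def operator (a : SesqForm H) : H →ₗ.[ℂ] H := a.operatorGraph.toLinearPMap

/-- `a` is the form associated with the operator `A`, that is, the closed sectorial form that
has `dom A` as a core and satisfies `(A u, v) = a[u, v]` for `u ∈ dom A`, `v ∈ dom a`. By the
first representation theorem an `m`-sectorial operator has exactly one such form. -/
def IsAssociated (a : SesqForm H) (A : H →ₗ.[ℂ] H) : Prop :=
  a.IsSectorial ∧ a.IsClosed ∧
  (∀ u : A.domain, ∃ hu : (u : H) ∈ a.domain, ∀ v : a.domain,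
    a.form ⟨u, hu⟩ v = inner ℂ (v : H) (A u)) ∧
  ∀ u : a.domain, ∃ x : ℕ → a.domain, (∀ n, (x n : H) ∈ A.domain) ∧
    Filter.Tendsto (fun n => (x n : H)) Filter.atTop (nhds (u : H)) ∧
    Filter.Tendsto (fun n => a.form (x n - u) (x n - u)) Filter.atTop (nhds 0)

end SesqForm

open Classical in
/-- The closed sectorial form associated with an `m`-sectorial operator (with a default value
for other operators). -/
def formOf (A : H →ₗ.[ℂ] H) : SesqForm H :=
  if h : ∃ a : SesqForm H, a.IsAssociated A then h.choose else ⟨⊥, 0⟩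

/-- The real part `A_R` of an `m`-sectorial operator `A`: the operator associated with the real
part of the form of `A`. -/
def realPartOp (A : H →ₗ.[ℂ] H) : H →ₗ.[ℂ] H := (formOf A).realPart.operator

/-! ### The operators built from `B` -/

variable [CompleteSpace H]

/-- The real part `(T + T*) / 2` of a bounded operator. -/
def reOp (T : H →L[ℂ] H) : H →L[ℂ] H := (1 / 2 : ℂ) • (T + ContinuousLinearMap.adjoint T)

/-- The imaginary part `(T - T*) / (2 i)` of a bounded operator. -/
def imOp (T : H →L[ℂ] H) : H →L[ℂ] H :=
  (1 / (2 * Complex.I)) • (T - ContinuousLinearMap.adjoint T)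

/-- The bounded operator `B^(-1/2)`, for an `m`-accretive operator `B` with bounded inverse. -/
def invSqrt (B : H →ₗ.[ℂ] H) : H →L[ℂ] H := boundedInv (sqrtOp B)

/-- The operator `Z = i (Re B^(-1/2))⁻¹ Im B^(-1/2)`. -/
def opZ (B : H →ₗ.[ℂ] H) : H →ₗ.[ℂ] H :=
  Complex.I • opMul (ofBounded (reOp (invSqrt B))).inverse (ofBounded (imOp (invSqrt B)))

end KatoSquareRoot

end

open KatoSquareRoot

noncomputable section

namespace KatoSquareRoot

section

variable {H : Type*} [NormedAddCommGroup H] [InnerProductSpace ℂ H]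

/-! ### The binomial series with exponent one half -/

/-! Everything is moved to bounded operators. Put `K` = B⁻¹, which is accretive, and `S` = B^(-1/2),
so that `S * S = K` and `star S` is the inverse root of B*. Domains become ranges of injective
bounded operators, and inclusions between such ranges are equivalent to norm estimates for the
adjoints (Douglas' lemma, `range_le_of_norm_star_le` and `norm_star_le_of_range_le`).

The key identity is `inner_mul_self_re`: Re(S²f, f) = ‖Rf‖² - ‖Jf‖² with R = Re S and J = Im S.
Accretivity of K thus means ‖Jf‖ ≤ ‖Rf‖, so J = WR with a contraction W (`exists_imFactor`).
Adjoints give J = RW*, hence Z = iW*, S = R(1 + Z) and S* = R(1 - Z). The range conditions on S, S*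
and R become surjectivity of 1 ± Z (`tfae_range_eq`).

In the sectorial case let P = (Re K)^(1/2), so ‖Pf‖² = ‖Rf‖² - ‖WRf‖². Then ‖W‖ < 1, an estimate
‖Rf‖ ≤ c‖Pf‖, and ran R = ran P all say the same. Sectoriality gives |(Kf, g)| ≤ C‖Pf‖‖Pg‖, and
since (Kf, g) = (Sf, S*g), an inclusion ran P ⊆ ran S forces ran S* ⊆ ran P
(`IsReSqrt.range_star_le`). This brings the range conditions back to ran R = ran P
(`tfae_range_eq_of_sectorial`).

It remains to see that dom B_R^(1/2) = ran P. Here K = PQP with Re Q = I, the form of B is b[Px, Py]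
= (Q⁻¹x, y) on ran P, and B_R⁻¹ = P(Re Q⁻¹)⁻¹P is comparable with P² (`sqrtOp_realPartOp_domain`).
-/

theorem succ_mul_choose_half (n : ℕ) :
    ((n : ℝ) + 1) * Ring.choose (1 / 2 : ℝ) (n + 1) =
      Ring.choose (1 / 2 : ℝ) n * (1 / 2 - n) := by
  have h := Ring.choose_smul_choose (1 / 2 : ℝ) (Nat.le_succ n)
  simpa [nsmul_eq_mul, Nat.choose_succ_self_right, Ring.choose_one_right] using h

/-- A closed form for the remainder: dropping the nonnegative second term bounds all partial sums by
2, which gives absolute convergence at ‖T‖ = 1. -/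
theorem sum_abs_choose_half (n : ℕ) :
    ∑ i ∈ Finset.range (n + 2), |Ring.choose (1 / 2 : ℝ) i| +
      (2 * n + 1) * |Ring.choose (1 / 2 : ℝ) (n + 1)| = 2 := by
  induction n with
  | zero =>
    simp [Finset.sum_range_succ, abs_of_pos]
    norm_num
  | succ n ih =>
    rw [Finset.sum_range_succ]
    have h := congrArg abs (succ_mul_choose_half (n + 1))
    rw [abs_mul, abs_mul, abs_of_pos (by positivity : (0 : ℝ) < ((n + 1 : ℕ) : ℝ) + 1),
      abs_of_nonpos (by push_cast; linarith [(n.cast_nonneg : (0 : ℝ) ≤ n)] :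
        (1 / 2 - ((n + 1 : ℕ) : ℝ)) ≤ 0)] at h
    push_cast at h ⊢
    linarith

theorem summable_abs_choose_half : Summable fun n => |Ring.choose (1 / 2 : ℝ) n| := by
  refine summable_of_sum_range_le (c := 2) (fun _ => abs_nonneg _) fun n => ?_
  have h := sum_abs_choose_half n
  have h' : ∑ i ∈ Finset.range n, |Ring.choose (1 / 2 : ℝ) i| ≤
      ∑ i ∈ Finset.range (n + 2), |Ring.choose (1 / 2 : ℝ) i| :=
    Finset.sum_le_sum_of_subset_of_nonneg (Finset.range_mono (by omega)) fun _ _ _ => abs_nonneg _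
  have : 0 ≤ (2 * (n : ℝ) + 1) * |Ring.choose (1 / 2 : ℝ) (n + 1)| := by positivity
  linarith

theorem summable_norm_sqrtOneAdd {T : H →L[ℂ] H} (hT : ‖T‖ ≤ 1) :
    Summable fun n : ℕ => ‖Ring.choose (1 / 2 : ℝ) n • T ^ n‖ := by
  refine Summable.of_nonneg_of_le (fun _ => norm_nonneg _) (fun n => ?_) summable_abs_choose_half
  rw [norm_smul, Real.norm_eq_abs]
  have h : ‖T ^ n‖ ≤ 1 := by
    -- The identity has norm 0 on the trivial space, so the exponent 0 is treated apart.
    rcases n.eq_zero_or_pos with rfl | hn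
    · exact ContinuousLinearMap.norm_id_le
    · exact (norm_pow_le' T hn).trans (pow_le_one₀ (norm_nonneg _) hT)
  exact mul_le_of_le_one_right (abs_nonneg _) h

variable [CompleteSpace H]

/-- By the Vandermonde identity the Cauchy product of the series with itself is the binomial series
with exponent 1, which stops after its linear term. -/
theorem sqrtOneAdd_mul_self {T : H →L[ℂ] H} (hT : ‖T‖ ≤ 1) :
    sqrtOneAdd T * sqrtOneAdd T = 1 + T := by
  rw [sqrtOneAdd, tsum_mul_tsum_eq_tsum_sum_antidiagonal_of_summable_norm
    (summable_norm_sqrtOneAdd hT) (summable_norm_sqrtOneAdd hT)]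
  have h : ∀ n : ℕ, ∑ kl ∈ Finset.HasAntidiagonal.antidiagonal n, Ring.choose (1 / 2 : ℝ) kl.1 • T ^ kl.1 *
      Ring.choose (1 / 2 : ℝ) kl.2 • T ^ kl.2 = Ring.choose (1 : ℝ) n • T ^ n := by
    intro n
    rw [show (1 : ℝ) = 1 / 2 + 1 / 2 by norm_num, Ring.add_choose_eq n (Commute.all _ _),
      Finset.sum_smul]
    refine Finset.sum_congr rfl fun kl hkl => ?_
    rw [smul_mul_smul_comm, ← pow_add, Finset.HasAntidiagonal.mem_antidiagonal.mp hkl]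
    norm_num
  simp_rw [h]
  rw [tsum_eq_sum (s := Finset.range 2)]
  · simp [Finset.sum_range_succ]
  · intro n hn
    have : (1 : ℝ) = ((1 : ℕ) : ℝ) := by simp
    rw [this, Ring.choose_natCast, Nat.choose_eq_zero_of_lt (by simpa using hn)]
    simp

theorem commute_sqrtOneAdd_right {A T : H →L[ℂ] H} (h : Commute A T) (hT : ‖T‖ ≤ 1) :
    Commute A (sqrtOneAdd T) := by
  have hs : Summable fun n : ℕ => Ring.choose (1 / 2 : ℝ) n • T ^ n :=
    (summable_norm_sqrtOneAdd hT).of_norm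
  rw [Commute, SemiconjBy, sqrtOneAdd, ← hs.tsum_mul_left, ← hs.tsum_mul_right]
  exact tsum_congr fun n => ((h.pow_right n).smul_right _)

theorem star_sqrtOneAdd (T : H →L[ℂ] H) : star (sqrtOneAdd T) = sqrtOneAdd (star T) := by
  rw [sqrtOneAdd, sqrtOneAdd, tsum_star]
  refine tsum_congr fun n => ?_
  rw [star_smul, star_pow, star_trivial]

/-! ### Bounded accretive operators -/

/-- `Re (K f, f) ≥ 0` for all `f`, for an everywhere defined bounded operator `K`. -/
def IsBoundedAccretive (K : H →L[ℂ] H) : Prop := ∀ f : H, 0 ≤ (inner ℂ f (K f)).re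

theorem inner_star_apply (K : H →L[ℂ] H) (f g : H) :
    inner ℂ f (star K g) = inner ℂ (K f) g := by
  rw [ContinuousLinearMap.star_eq_adjoint, ContinuousLinearMap.adjoint_inner_right]

theorem star_inner_apply (K : H →L[ℂ] H) (f g : H) :
    inner ℂ (star K f) g = inner ℂ f (K g) := by
  rw [ContinuousLinearMap.star_eq_adjoint, ContinuousLinearMap.adjoint_inner_left]

theorem re_inner_star_apply_self (K : H →L[ℂ] H) (f : H) :
    (inner ℂ f (star K f)).re = (inner ℂ f (K f)).re := by
  rw [inner_star_apply, ← inner_conj_symm, Complex.conj_re]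

protected theorem IsBoundedAccretive.star {K : H →L[ℂ] H} (hK : IsBoundedAccretive K) :
    IsBoundedAccretive (star K) := fun f => by
  rw [re_inner_star_apply_self]; exact hK f

theorem isUnit_of_coercive {Q : H →L[ℂ] H} {c : ℝ} (hc : 0 < c)
    (h : ∀ x, c * ‖x‖ ^ 2 ≤ (inner ℂ x (Q x)).re) : IsUnit Q := by
  refine ContinuousLinearMap.isUnit_of_forall_le_norm_inner_map Q (c := ⟨c, hc.le⟩) hc fun x => ?_
  rw [norm_inner_symm, mul_comm]
  exact (h x).trans (Complex.re_le_norm _)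

theorem IsBoundedAccretive.isUnit_one_add {K : H →L[ℂ] H} (hK : IsBoundedAccretive K) :
    IsUnit (1 + K) := by
  refine isUnit_of_coercive one_pos fun x => ?_
  have h : (inner ℂ x ((1 + K) x)).re = ‖x‖ ^ 2 + (inner ℂ x (K x)).re := by
    rw [add_apply, one_apply_eq_self, inner_add_right,
      Complex.add_re, inner_self_eq_norm_sq_to_K]
    norm_cast
  linarith [hK x]

/-- The Cayley transform `(K - I)(K + I)⁻¹` of the (possibly unbounded) inverse of `K`. -/
def invCayley (K : H →L[ℂ] H) : H →L[ℂ] H := (2 : ℂ) • (K * Ring.inverse (1 + K)) - 1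

theorem invCayley_mul {K : H →L[ℂ] H} (hK : IsBoundedAccretive K) :
    invCayley K * (1 + K) = K - 1 := by
  rw [invCayley, sub_mul, smul_mul_assoc, mul_assoc, Ring.inverse_mul_cancel _ hK.isUnit_one_add,
    two_smul]
  noncomm_ring

/-- With x = (1 + K)g, the difference ‖(K + 1)g‖² - ‖(K - 1)g‖² is 4 Re(Kg, g) ≥ 0. -/
theorem norm_invCayley_le {K : H →L[ℂ] H} (hK : IsBoundedAccretive K) : ‖invCayley K‖ ≤ 1 := by
  refine ContinuousLinearMap.opNorm_le_bound _ zero_le_one fun x => ?_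
  set g := Ring.inverse (1 + K) x with hg
  have hx : (1 + K) g = x := by
    rw [hg, ← mul_apply_eq_comp, Ring.mul_inverse_cancel _ hK.isUnit_one_add,
      one_apply_eq_self]
  have hx' : invCayley K x = (K - 1) g := by
    rw [← invCayley_mul hK, mul_apply_eq_comp, hx]
  rw [hx', ← hx, one_mul]
  refine le_of_sq_le_sq ?_ (norm_nonneg _)
  simp only [sub_apply, add_apply,
    one_apply_eq_self]
  rw [@norm_sub_sq ℂ, @norm_add_sq ℂ]
  have h := hK g
  have h' : (inner ℂ (K g) g).re = (inner ℂ g (K g)).re := by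
    rw [← inner_conj_symm, Complex.conj_re]
  simp only [RCLike.re_to_complex, h']
  linarith

omit [CompleteSpace H] in
theorem one_add_invCayley (K : H →L[ℂ] H) :
    1 + invCayley K = (2 : ℂ) • (K * Ring.inverse (1 + K)) := by
  rw [invCayley]; abel

theorem one_sub_invCayley {K : H →L[ℂ] H} (hK : IsBoundedAccretive K) :
    1 - invCayley K = (2 : ℂ) • Ring.inverse (1 + K) := by
  have h : (1 + K) * Ring.inverse (1 + K) = 1 := Ring.mul_inverse_cancel _ hK.isUnit_one_add
  rw [add_mul, one_mul] at h
  rw [invCayley, eq_sub_of_add_eq' h, smul_sub, two_smul ℂ (1 : H →L[ℂ] H)]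
  abel

theorem commute_ringInverse_right {M : Type*} [MonoidWithZero M] {a b : M} (h : Commute a b)
    (hb : IsUnit b) : Commute a (Ring.inverse b) := by
  obtain ⟨u, rfl⟩ := hb
  rw [Ring.inverse_unit]
  exact h.units_inv_right

theorem commute_ringInverse_one_add {K : H →L[ℂ] H} (hK : IsBoundedAccretive K) :
    Commute K (Ring.inverse (1 + K)) :=
  commute_ringInverse_right ((Commute.one_right K).add_right (Commute.refl K)) hK.isUnit_one_add

theorem star_invCayley {K : H →L[ℂ] H} (hK : IsBoundedAccretive K) :
    star (invCayley K) = invCayley (star K) := by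
  rw [invCayley, invCayley, star_sub, star_one, star_smul, star_mul, ← Ring.inverse_star, star_add,
    star_one, (commute_ringInverse_one_add hK.star).eq]
  simp

/-- The square root of a bounded accretive operator `K`. -/
def accretiveSqrt (K : H →L[ℂ] H) : H →L[ℂ] H :=
  sqrtOneAdd (invCayley K) * Ring.inverse (sqrtOneAdd (-invCayley K))

section

variable {K : H →L[ℂ] H}

theorem IsBoundedAccretive.sqrtOneAdd_invCayley_mul_self (hK : IsBoundedAccretive K) :
    sqrtOneAdd (invCayley K) * sqrtOneAdd (invCayley K) = (2 : ℂ) • (K * Ring.inverse (1 + K)) := by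
  rw [sqrtOneAdd_mul_self (norm_invCayley_le hK), one_add_invCayley]

theorem IsBoundedAccretive.sqrtOneAdd_neg_invCayley_mul_self (hK : IsBoundedAccretive K) :
    sqrtOneAdd (-invCayley K) * sqrtOneAdd (-invCayley K) = (2 : ℂ) • Ring.inverse (1 + K) := by
  rw [sqrtOneAdd_mul_self (by rw [norm_neg]; exact norm_invCayley_le hK), ← sub_eq_add_neg,
    one_sub_invCayley hK]

theorem IsBoundedAccretive.isUnit_sqrtOneAdd_neg_invCayley (hK : IsBoundedAccretive K) :
    IsUnit (sqrtOneAdd (-invCayley K)) := by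
  refine (isUnit_pow_iff two_ne_zero).mp ?_
  rw [pow_two, hK.sqrtOneAdd_neg_invCayley_mul_self]
  exact (hK.isUnit_one_add.ringInverse).smul (Units.mk0 (2 : ℂ) two_ne_zero)

theorem IsBoundedAccretive.commute_sqrtOneAdd (hK : IsBoundedAccretive K) :
    Commute (sqrtOneAdd (invCayley K)) (sqrtOneAdd (-invCayley K)) := by
  have hT := norm_invCayley_le hK
  refine commute_sqrtOneAdd_right (Commute.neg_right ?_) (by rwa [norm_neg])
  exact (commute_sqrtOneAdd_right (Commute.refl _) hT).symm

/-- The commuting factors X, Y satisfy X² = 2K(1 + K)⁻¹ and Y² = 2(1 + K)⁻¹, so (XY⁻¹)² = K. -/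
theorem IsBoundedAccretive.accretiveSqrt_mul_self (hK : IsBoundedAccretive K) :
    accretiveSqrt K * accretiveSqrt K = K := by
  have hY := hK.isUnit_sqrtOneAdd_neg_invCayley
  have hX2 := hK.sqrtOneAdd_invCayley_mul_self
  have hY2 := hK.sqrtOneAdd_neg_invCayley_mul_self
  have hc := commute_ringInverse_right hK.commute_sqrtOneAdd hY
  rw [accretiveSqrt]
  set X := sqrtOneAdd (invCayley K)
  set Y := sqrtOneAdd (-invCayley K)
  have h1 : Y * Ring.inverse Y = 1 := Ring.mul_inverse_cancel _ hY
  have hXY : X * X = K * (Y * Y) := by rw [hX2, hY2, mul_smul_comm]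
  calc X * Ring.inverse Y * (X * Ring.inverse Y)
      = X * (Ring.inverse Y * X) * Ring.inverse Y := by noncomm_ring
    _ = X * X * Ring.inverse Y * Ring.inverse Y := by rw [← hc.eq]; noncomm_ring
    _ = K * (Y * (Y * Ring.inverse Y) * Ring.inverse Y) := by rw [hXY]; noncomm_ring
    _ = K := by rw [h1, mul_one, h1, mul_one]

theorem IsBoundedAccretive.star_accretiveSqrt (hK : IsBoundedAccretive K) :
    star (accretiveSqrt K) = accretiveSqrt (star K) := by
  have hc := commute_ringInverse_right hK.star.commute_sqrtOneAdd
    hK.star.isUnit_sqrtOneAdd_neg_invCayley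
  rw [accretiveSqrt, accretiveSqrt, star_mul, ← Ring.inverse_star, star_sqrtOneAdd,
    star_sqrtOneAdd, star_neg, star_invCayley hK, hc.eq]

end

end

section

variable {H : Type*} [NormedAddCommGroup H] [InnerProductSpace ℂ H]

/-! ### Graphs and bounded inverses -/

theorem mem_graph_ofBounded (T : H →L[ℂ] H) (x y : H) :
    (x, y) ∈ (ofBounded T).graph ↔ T x = y := by
  rw [LinearPMap.mem_graph_iff]
  exact ⟨fun ⟨z, hz, hy⟩ => by subst hz; exact hy, fun h => ⟨⟨x, trivial⟩, rfl, h⟩⟩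

theorem mem_graph_opMul (A C : H →ₗ.[ℂ] H) (x z : H) :
    (x, z) ∈ (opMul A C).graph ↔ ∃ y, (x, y) ∈ C.graph ∧ (y, z) ∈ A.graph := by
  rw [LinearPMap.mem_graph_iff]
  constructor
  · rintro ⟨⟨_, u, hu, rfl⟩, rfl, rfl⟩
    exact ⟨C u, LinearPMap.mem_graph _ u, LinearPMap.mem_graph A ⟨C u, hu⟩⟩
  · rintro ⟨y, hxy, hyz⟩
    obtain ⟨u, rfl, rfl⟩ := (LinearPMap.mem_graph_iff _).mp hxy
    obtain ⟨v, hv, rfl⟩ := (LinearPMap.mem_graph_iff _).mp hyz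
    refine ⟨⟨u, u, ?_, rfl⟩, rfl, ?_⟩
    · change C u ∈ A.domain
      exact (show (v : H) = C u from hv) ▸ v.2
    · change A _ = A v
      congr 1
      exact Subtype.ext hv.symm

theorem mem_graph_add (A C : H →ₗ.[ℂ] H) (x z : H) :
    (x, z) ∈ (A + C).graph ↔ ∃ y y', (x, y) ∈ A.graph ∧ (x, y') ∈ C.graph ∧ y + y' = z := by
  simp only [LinearPMap.mem_graph_iff]
  constructor
  · rintro ⟨u, rfl, rfl⟩
    exact ⟨_, _, ⟨⟨u, u.2.1⟩, rfl, rfl⟩, ⟨⟨u, u.2.2⟩, rfl, rfl⟩, rfl⟩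
  · rintro ⟨_, _, ⟨u, rfl, rfl⟩, ⟨v, hv, rfl⟩, rfl⟩
    refine ⟨⟨u, u.2, hv ▸ v.2⟩, rfl, ?_⟩
    rw [LinearPMap.add_apply]
    congr 2
    exact Subtype.ext hv.symm

theorem ofBounded_add (S T : H →L[ℂ] H) : ofBounded S + ofBounded T = ofBounded (S + T) := by
  refine LinearPMap.eq_of_eq_graph (Submodule.ext fun ⟨x, z⟩ => ?_)
  simp only [mem_graph_add, mem_graph_ofBounded, add_apply]
  exact ⟨fun ⟨_, _, hy, hy', h⟩ => hy ▸ hy' ▸ h, fun h => ⟨_, _, rfl, rfl, h⟩⟩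

theorem ofBounded_sub (S T : H →L[ℂ] H) : ofBounded S - ofBounded T = ofBounded (S - T) := by
  rw [sub_eq_add_neg, sub_eq_add_neg, ← ofBounded_add]
  rfl

theorem ofBounded_mul (S T : H →L[ℂ] H) : opMul (ofBounded S) (ofBounded T) = ofBounded (S * T) := by
  refine LinearPMap.eq_of_eq_graph (Submodule.ext fun ⟨x, z⟩ => ?_)
  simp only [mem_graph_opMul, mem_graph_ofBounded, exists_eq_left', mul_apply_eq_comp]

theorem ran_ofBounded (T : H →L[ℂ] H) : ran (ofBounded T) = T.range := by
  ext y
  exact ⟨fun ⟨x, hx⟩ => ⟨x, hx⟩, fun ⟨x, hx⟩ => ⟨⟨x, trivial⟩, hx⟩⟩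

theorem opNorm_ofBounded (T : H →L[ℂ] H) : opNorm (ofBounded T) = ‖T‖ₑ := by
  refine le_antisymm (iSup₂_le fun x hx => ?_) ?_
  · refine (T.le_opENorm x).trans ?_
    refine mul_le_of_le_one_right' ?_
    rw [← ofReal_norm]
    exact ENNReal.ofReal_le_one.mpr hx
  · refine le_of_forall_lt_imp_le_of_dense fun c hc => ?_
    lift c to NNReal using hc.ne_top
    obtain ⟨x, hx, hcx⟩ := T.exists_lt_apply_of_lt_opNNNorm (ENNReal.coe_lt_coe.mp hc)
    exact (ENNReal.coe_lt_coe.mpr hcx).le.trans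
      (le_iSup₂_of_le (⟨x, trivial⟩ : (ofBounded T).domain) (NNReal.coe_le_coe.mpr hx.le) le_rfl)

theorem mem_graph_inverse {T : H →L[ℂ] H} (hT : ∀ x, T x = 0 → x = 0) (x y : H) :
    (x, y) ∈ (ofBounded T).inverse.graph ↔ T y = x := by
  have h : LinearMap.ker (ofBounded T).toFun = ⊥ :=
    LinearMap.ker_eq_bot'.mpr fun m hm => Subtype.ext (hT m hm)
  rw [LinearPMap.inverse_graph h, ← mem_graph_ofBounded]
  simp

theorem inverse_ofBounded_domain (T : H →L[ℂ] H) :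
    (ofBounded T).inverse.domain = T.range := by
  rw [LinearPMap.inverse_domain, ← ran_ofBounded]
  rfl

theorem IsBoundedInverse.mem_graph {A : H →ₗ.[ℂ] H} {K : H →L[ℂ] H} (h : IsBoundedInverse A K)
    (x y : H) : (x, y) ∈ A.graph ↔ K y = x := by
  refine ⟨fun hxy => ?_, fun hxy => hxy ▸ h.1 y⟩
  obtain ⟨u, rfl, rfl⟩ := (LinearPMap.mem_graph_iff _).mp hxy
  exact h.2 u

theorem isBoundedInverse_iff {A : H →ₗ.[ℂ] H} {K : H →L[ℂ] H} :
    IsBoundedInverse A K ↔ ∀ x y, (x, y) ∈ A.graph ↔ K y = x :=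
  ⟨fun h => h.mem_graph, fun h => ⟨fun _ => (h _ _).mpr rfl,
    fun x => (h _ _).mp (LinearPMap.mem_graph _ x)⟩⟩

/-- This turns the domains in the theorem into ranges of bounded operators. -/
theorem IsBoundedInverse.domain_eq {A : H →ₗ.[ℂ] H} {K : H →L[ℂ] H} (h : IsBoundedInverse A K) :
    A.domain = K.range := by
  ext x
  rw [LinearPMap.mem_domain_iff]
  exact exists_congr fun y => h.mem_graph x y

theorem IsBoundedInverse.eq_zero {A : H →ₗ.[ℂ] H} {K : H →L[ℂ] H} (h : IsBoundedInverse A K)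
    {x : H} (hx : K x = 0) : x = 0 := by
  have := (h.mem_graph 0 x).mpr hx
  exact LinearPMap.graph_fst_eq_zero_snd _ this rfl

theorem IsBoundedInverse.boundedInv_eq {A : H →ₗ.[ℂ] H} {K : H →L[ℂ] H}
    (h : IsBoundedInverse A K) : boundedInv A = K := by
  have hA : HasBoundedInverse A := ⟨K, h⟩
  rw [boundedInv, dif_pos hA]
  ext y
  exact (((h.mem_graph _ y).mp (hA.choose_spec.1 y))).symm

theorem IsBoundedInverse.isBoundedAccretive {A : H →ₗ.[ℂ] H} {K : H →L[ℂ] H}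
    (h : IsBoundedInverse A K) (hA : IsAccretive A) : IsBoundedAccretive K := by
  intro f
  obtain ⟨u, hu, hf⟩ := (LinearPMap.mem_graph_iff _).mp (h.1 f)
  have := hA u
  simp only at hu hf
  rw [hu, hf, ← inner_conj_symm, Complex.conj_re] at this
  exact this

variable [CompleteSpace H]

theorem IsBoundedInverse.cayley_eq {A : H →ₗ.[ℂ] H} {K : H →L[ℂ] H} (h : IsBoundedInverse A K)
    (hK : IsBoundedAccretive K) : cayley A = invCayley K := by
  have h' : IsBoundedInverse (idOp + A) (K * Ring.inverse (1 + K)) := by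
    refine isBoundedInverse_iff.mpr fun x y => ?_
    have hu := hK.isUnit_one_add
    have h1 : (x, y) ∈ (idOp + A).graph ↔ K (y - x) = x := by
      rw [mem_graph_add, ← h.mem_graph]
      simp only [idOp, mem_graph_ofBounded, ContinuousLinearMap.id_apply]
      exact ⟨fun ⟨_, _, h1, h2, h3⟩ => by rwa [← h3, ← h1, add_sub_cancel_left],
        fun hx => ⟨_, _, rfl, hx, add_sub_cancel _ _⟩⟩
    rw [h1]
    constructor
    · intro hx
      have hy : y = (1 + K) (y - x) := by
        rw [add_apply, one_apply_eq_self, hx, sub_add_cancel]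
      rw [mul_apply_eq_comp]
      nth_rw 1 [hy]
      rw [← mul_apply_eq_comp (Ring.inverse _), Ring.inverse_mul_cancel _ hu, one_apply_eq_self, hx]
    · intro hx
      have hy : (1 + K) (Ring.inverse (1 + K) y) = y := by
        rw [← mul_apply_eq_comp, Ring.mul_inverse_cancel _ hu, one_apply_eq_self]
      rw [mul_apply_eq_comp] at hx
      rw [add_apply, one_apply_eq_self, hx] at hy
      rw [← eq_sub_iff_add_eq.mpr hy, hx]
  rw [cayley, h'.boundedInv_eq]
  rfl

/-- The Cayley transform of A is `invCayley K`, so A^(1/2) = YX⁻¹, whose inverse is XY⁻¹.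
Injectivity of X follows from X² = 2(1 + K)⁻¹K and that of K. -/
protected theorem IsBoundedInverse.sqrtOp {A : H →ₗ.[ℂ] H} {K : H →L[ℂ] H} (h : IsBoundedInverse A K)
    (hK : IsBoundedAccretive K) : IsBoundedInverse (sqrtOp A) (accretiveSqrt K) := by
  rw [KatoSquareRoot.sqrtOp, h.cayley_eq hK, accretiveSqrt]
  have hX2 := hK.sqrtOneAdd_invCayley_mul_self
  have hu := hK.isUnit_sqrtOneAdd_neg_invCayley
  have hc := commute_ringInverse_one_add hK
  set X := sqrtOneAdd (invCayley K)
  set Y := sqrtOneAdd (-invCayley K)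
  have hX : ∀ x, X x = 0 → x = 0 := by
    intro x hx
    have h0 : (X * X) x = 0 := by rw [mul_apply_eq_comp, hx, map_zero]
    rw [hX2, hc.eq, smul_apply, mul_apply_eq_comp] at h0
    have h1 := (smul_eq_zero.mp h0).resolve_left two_ne_zero
    have h2 : K x = 0 := by
      rw [← one_apply_eq_self (F := H →L[ℂ] H) (K x), ← Ring.mul_inverse_cancel _ hK.isUnit_one_add,
        mul_apply_eq_comp, h1, map_zero]
    exact h.eq_zero h2
  refine isBoundedInverse_iff.mpr fun x y => ?_
  simp only [mem_graph_opMul, mem_graph_inverse hX, mem_graph_ofBounded, mul_apply_eq_comp]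
  constructor
  · rintro ⟨z, rfl, rfl⟩
    rw [← mul_apply_eq_comp _ Y, Ring.inverse_mul_cancel _ hu, one_apply_eq_self]
  · rintro rfl
    refine ⟨_, rfl, ?_⟩
    rw [← mul_apply_eq_comp, Ring.mul_inverse_cancel _ hu, one_apply_eq_self]

protected theorem IsBoundedInverse.adjoint {A : H →ₗ.[ℂ] H} {K : H →L[ℂ] H}
    (h : IsBoundedInverse A K) (hA : Dense (A.domain : Set H)) :
    IsBoundedInverse A.adjoint (star K) := by
  constructor
  · intro y
    have hy : ∀ x : A.domain, inner ℂ y (x : H) = inner ℂ (star K y) (A x) := fun x => by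
      rw [star_inner_apply, h.2 x]
    have hd : star K y ∈ A.adjoint.domain := LinearPMap.mem_adjoint_domain_of_exists _ ⟨y, hy⟩
    exact (LinearPMap.mem_graph_iff _).mpr
      ⟨⟨_, hd⟩, rfl, LinearPMap.adjoint_apply_eq hA ⟨_, hd⟩ hy⟩
  · intro x
    refine ext_inner_right ℂ fun f => ?_
    obtain ⟨u, hu, hf⟩ := (LinearPMap.mem_graph_iff _).mp (h.1 f)
    simp only at hu hf
    rw [star_inner_apply, ← hu, LinearPMap.adjoint_isFormalAdjoint hA x u, hf]

end

section

variable {H : Type*} [NormedAddCommGroup H] [InnerProductSpace ℂ H]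

theorem exists_norm_le_of_isBoundedOp {A : H →ₗ.[ℂ] H} (hA : IsBoundedOp A) :
    ∃ M : ℝ, 0 ≤ M ∧ ∀ x y, (x, y) ∈ A.graph → ‖y‖ ≤ M * ‖x‖ := by
  refine ⟨(opNorm A).toReal, ENNReal.toReal_nonneg, fun x y hxy => ?_⟩
  obtain ⟨u, rfl, rfl⟩ := (LinearPMap.mem_graph_iff _).mp hxy
  rcases eq_or_ne u 0 with rfl | hu
  · simp
  have hu' : 0 < ‖u‖ := norm_pos_iff.mpr hu
  set v : A.domain := ((‖u‖⁻¹ : ℝ) : ℂ) • u with hv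
  have hv1 : ‖v‖ ≤ 1 := by
    rw [hv, norm_smul, Complex.norm_real, norm_inv, norm_norm, inv_mul_cancel₀ hu'.ne']
  have h : ‖A v‖ₑ ≤ opNorm A := le_iSup₂_of_le (f := fun (x : A.domain) (_ : ‖x‖ ≤ 1) => ‖A x‖ₑ)
    v hv1 le_rfl
  have h' := ENNReal.toReal_mono (ne_of_lt hA) h
  rw [toReal_enorm, hv, LinearPMap.map_smul, norm_smul, Complex.norm_real, norm_inv, norm_norm,
    inv_mul_le_iff₀ hu'] at h'
  rw [mul_comm]
  exact h'

/-! ### Factorization of bounded operators -/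

theorem eq_of_apply_eq {C : H →L[ℂ] H} (hC : ∀ x, C x = 0 → x = 0) {x y : H}
    (h : C x = C y) : x = y :=
  sub_eq_zero.mp (hC _ (by rw [map_sub, h, sub_self]))

theorem eq_of_mul_eq_mul {C A D : H →L[ℂ] H} (hC : ∀ x, C x = 0 → x = 0)
    (h : C * A = C * D) : A = D := by
  ext x
  exact eq_of_apply_eq hC (DFunLike.congr_fun h x)

variable [CompleteSpace H]

theorem denseRange_of_star_injective {C : H →L[ℂ] H} (hC : ∀ x, star C x = 0 → x = 0) :
    DenseRange C := by
  have h : C.rangeᗮ = ⊥ := by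
    rw [ContinuousLinearMap.orthogonal_range]
    exact LinearMap.ker_eq_bot'.mpr hC
  have := (Submodule.topologicalClosure_eq_top_iff (K := C.range)).mpr h
  rw [← Submodule.dense_iff_topologicalClosure_eq_top] at this
  exact this

/-- The map Cf ↦ Af is well defined and bounded on the dense range of C; D is its continuous
extension. -/
theorem exists_eq_mul_of_norm_le {A C : H →L[ℂ] H} (hC : DenseRange C) {c : ℝ} (hc : 0 ≤ c)
    (h : ∀ f, ‖A f‖ ≤ c * ‖C f‖) : ∃ D : H →L[ℂ] H, A = D * C ∧ ‖D‖ ≤ c := by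
  refine ⟨A.toLinearMap.extendOfNorm C.toLinearMap, ?_,
    LinearMap.opNorm_extendOfNorm_le hC hc h⟩
  ext x
  exact (LinearMap.extendOfNorm_eq (f := A.toLinearMap) (e := C.toLinearMap) hC ⟨c, h⟩ x).symm

theorem range_le_of_norm_star_le {A C : H →L[ℂ] H} (hC : ∀ x, C x = 0 → x = 0) {c : ℝ}
    (hc : 0 ≤ c) (h : ∀ f, ‖star A f‖ ≤ c * ‖star C f‖) : A.range ≤ C.range := by
  obtain ⟨D, hD, -⟩ := exists_eq_mul_of_norm_le
    (denseRange_of_star_injective (by rwa [star_star])) hc h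
  rw [← star_star A, hD, star_mul, star_star]
  rintro _ ⟨x, rfl⟩
  exact ⟨star D x, rfl⟩

/-- X = C⁻¹A is everywhere defined and closed, hence bounded by the closed graph theorem. -/
theorem exists_eq_mul_of_range_le {A C : H →L[ℂ] H} (hC : ∀ x, C x = 0 → x = 0)
    (h : A.range ≤ C.range) : ∃ X : H →L[ℂ] H, A = C * X := by
  choose X hX using fun f => h ⟨f, rfl⟩
  have hX' : ∀ f, C (X f) = A f := hX
  let X₁ : H →ₗ[ℂ] H :=
    { toFun := X
      map_add' := fun x y => eq_of_apply_eq hC (by simp only [map_add, hX'])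
      map_smul' := fun c x => eq_of_apply_eq hC (by simp [hX']) }
  have hc : Continuous X₁ := by
    refine X₁.continuous_of_seq_closed_graph fun u x y hu hy => ?_
    refine eq_of_apply_eq hC (Eq.trans ?_ (hX' x).symm)
    refine tendsto_nhds_unique ((C.continuous.tendsto y).comp hy) ?_
    have : C ∘ X₁ ∘ u = A ∘ u := funext fun n => hX' (u n)
    rw [this]
    exact (A.continuous.tendsto x).comp hu
  exact ⟨⟨X₁, hc⟩, ContinuousLinearMap.ext fun f => (hX' f).symm⟩

theorem norm_star_le_of_range_le {A C : H →L[ℂ] H} (hC : ∀ x, C x = 0 → x = 0)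
    (h : A.range ≤ C.range) : ∃ c : ℝ, 0 ≤ c ∧ ∀ f, ‖star A f‖ ≤ c * ‖star C f‖ := by
  obtain ⟨X, rfl⟩ := exists_eq_mul_of_range_le hC h
  refine ⟨‖star X‖, norm_nonneg _, fun f => ?_⟩
  rw [star_mul]
  exact (star X).le_opNorm _

theorem isUnit_of_norm_le {Q : H →L[ℂ] H} {c : ℝ} (hc : 0 < c) (h : ∀ x, c * ‖x‖ ≤ ‖Q x‖)
    (hQ : ∀ x, star Q x = 0 → x = 0) : IsUnit Q := by
  have ha : AntilipschitzWith (⟨c⁻¹, (inv_pos.mpr hc).le⟩ : NNReal) Q :=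
    Q.antilipschitz_of_bound fun x => by
      change _ ≤ c⁻¹ * _
      rw [le_inv_mul_iff₀ hc]
      exact h x
  rw [ContinuousLinearMap.isUnit_iff_bijective]
  refine ⟨ha.injective, Set.range_eq_univ.mp ?_⟩
  rw [← (ha.isClosed_range Q.uniformContinuous).closure_eq]
  exact (denseRange_of_star_injective hQ).closure_eq

omit [CompleteSpace H] in
theorem exists_norm_le_of_isUnit {Q : H →L[ℂ] H} (hQ : IsUnit Q) :
    ∃ c : ℝ, 0 < c ∧ ∀ x, c * ‖x‖ ≤ ‖Q x‖ := by
  -- The added 1 keeps the constant positive on the trivial space.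
  refine ⟨(‖Ring.inverse Q‖ + 1)⁻¹, by positivity, fun x => ?_⟩
  rw [inv_mul_le_iff₀ (by positivity)]
  calc ‖x‖ = ‖Ring.inverse Q (Q x)‖ := by
        rw [← mul_apply_eq_comp, Ring.inverse_mul_cancel _ hQ, one_apply_eq_self]
    _ ≤ ‖Ring.inverse Q‖ * ‖Q x‖ := ContinuousLinearMap.le_opNorm _ _
    _ ≤ _ := by nlinarith [norm_nonneg (Q x)]

/-- For a contraction, Z*g = -g implies Zg = -g: expanding gives ‖(1 + Z)g‖² = ‖Zg‖² - ‖g‖² ≤ 0. The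
lower bound thus also kills the kernel of the adjoint. -/
theorem isUnit_one_add_of_norm_le {Z : H →L[ℂ] H} (hZ : ‖Z‖ ≤ 1) {c : ℝ} (hc : 0 < c)
    (h : ∀ x, c * ‖x‖ ≤ ‖(1 + Z) x‖) : IsUnit (1 + Z) := by
  refine isUnit_of_norm_le hc h fun g hg => ?_
  have hg' : g + star Z g = 0 := by simpa using hg
  have h1 : (inner ℂ g (Z g)).re = -‖g‖ ^ 2 := by
    rw [← re_inner_star_apply_self, eq_neg_of_add_eq_zero_right hg', inner_neg_right,
      Complex.neg_re, inner_self_eq_norm_sq_to_K]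
    norm_cast
  have h2 : ‖Z g‖ ≤ ‖g‖ := (Z.le_of_opNorm_le hZ g).trans_eq (one_mul _)
  have h3 : ‖(1 + Z) g‖ ^ 2 ≤ 0 := by
    rw [add_apply, one_apply_eq_self, @norm_add_sq ℂ, RCLike.re_to_complex, h1]
    nlinarith [norm_nonneg (Z g)]
  have h4 : ‖(1 + Z) g‖ = 0 := by nlinarith [norm_nonneg ((1 + Z) g)]
  have h5 := h g
  rw [h4] at h5
  exact norm_eq_zero.mp (le_antisymm (nonpos_of_mul_nonpos_right h5 hc) (norm_nonneg _))

/-! ### Real and imaginary parts -/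

theorem reOp_add_imOp (S : H →L[ℂ] H) : reOp S + Complex.I • imOp S = S := by
  rw [reOp, imOp, smul_smul, show Complex.I * (1 / (2 * Complex.I)) = 1 / 2 by field_simp,
    ← smul_add, add_add_sub_cancel, ← two_smul ℂ, smul_smul]
  norm_num

theorem star_reOp (S : H →L[ℂ] H) : star (reOp S) = reOp S := by
  rw [reOp, ← ContinuousLinearMap.star_eq_adjoint, star_smul, star_add, star_star, add_comm]
  simp

theorem star_imOp (S : H →L[ℂ] H) : star (imOp S) = imOp S := by
  rw [imOp, ← ContinuousLinearMap.star_eq_adjoint, star_smul, star_sub, star_star,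
    ← neg_sub, smul_neg, ← neg_smul]
  congr 1
  simp

theorem reOp_sub_imOp (S : H →L[ℂ] H) : reOp S - Complex.I • imOp S = star S := by
  rw [← reOp_add_imOp S, star_add, star_smul, star_reOp, star_imOp, reOp_add_imOp S]
  simp [sub_eq_add_neg]

theorem reOp_star (S : H →L[ℂ] H) : reOp (star S) = reOp S := by
  rw [reOp, reOp, ← ContinuousLinearMap.star_eq_adjoint, ← ContinuousLinearMap.star_eq_adjoint,
    star_star, add_comm]

theorem imOp_star (S : H →L[ℂ] H) : imOp (star S) = -imOp S := by
  rw [imOp, imOp, ← ContinuousLinearMap.star_eq_adjoint, ← ContinuousLinearMap.star_eq_adjoint,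
    star_star, ← smul_neg, neg_sub]

theorem inner_reOp_self (K : H →L[ℂ] H) (f : H) :
    inner ℂ f (reOp K f) = ((inner ℂ f (K f)).re : ℂ) := by
  rw [reOp, smul_apply, add_apply, ← ContinuousLinearMap.star_eq_adjoint, inner_smul_right,
    inner_add_right, inner_star_apply, ← inner_conj_symm (K f) f, Complex.add_conj]
  push_cast; ring

/-- Since (S²f, f) = (Sf, S*f) with Sf = Rf + iJf and S*f = Rf - iJf, the cross terms add up to a
purely imaginary number. -/
theorem inner_mul_self_re (S : H →L[ℂ] H) (f : H) :
    (inner ℂ f ((S * S) f)).re = ‖reOp S f‖ ^ 2 - ‖imOp S f‖ ^ 2 := by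
  have h1 : S f = reOp S f + Complex.I • imOp S f := by
    rw [← smul_apply, ← add_apply, reOp_add_imOp]
  have h2 : star S f = reOp S f - Complex.I • imOp S f := by
    rw [← smul_apply, ← sub_apply, reOp_sub_imOp]
  rw [mul_apply_eq_comp, ← star_inner_apply, h2, h1, inner_sub_left, inner_add_right,
    inner_add_right, inner_smul_left, inner_smul_right, inner_smul_left, inner_smul_right,
    inner_self_eq_norm_sq_to_K, inner_self_eq_norm_sq_to_K]
  have h := inner_im_symm (𝕜 := ℂ) (reOp S f) (imOp S f)
  simp only [RCLike.im_to_complex] at h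
  simp [← Complex.ofReal_pow, h]
  ring

theorem norm_sq_add_norm_star_sq (S : H →L[ℂ] H) (f : H) :
    ‖star S f‖ ^ 2 + ‖S f‖ ^ 2 = 2 * (‖reOp S f‖ ^ 2 + ‖imOp S f‖ ^ 2) := by
  have h1 : S f = reOp S f + Complex.I • imOp S f := by
    rw [← smul_apply, ← add_apply, reOp_add_imOp]
  have h2 : star S f = reOp S f - Complex.I • imOp S f := by
    rw [← smul_apply, ← sub_apply, reOp_sub_imOp]
  have h := parallelogram_law_with_norm ℂ (reOp S f) (Complex.I • imOp S f)
  rw [norm_smul, Complex.norm_I, one_mul] at h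
  rw [h1, h2]
  nlinarith [h]

/-- The factorization `Im S = W Re S` with a contraction `W`. -/
structure ImFactor (S W : H →L[ℂ] H) : Prop where
  injective : ∀ x, reOp S x = 0 → x = 0
  im_eq : imOp S = W * reOp S
  norm_le : ‖W‖ ≤ 1

theorem exists_imFactor {S : H →L[ℂ] H} (hS : ∀ x, S x = 0 → x = 0)
    (hacc : IsBoundedAccretive (S * S)) : ∃ W, ImFactor S W := by
  have hle : ∀ f, ‖imOp S f‖ ≤ 1 * ‖reOp S f‖ := fun f => by
    have h := hacc f
    rw [inner_mul_self_re] at h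
    rw [one_mul]
    exact le_of_sq_le_sq (by linarith) (norm_nonneg _)
  have hinj : ∀ x, reOp S x = 0 → x = 0 := fun x hx => by
    have h := hle x
    rw [hx, norm_zero, mul_zero, norm_le_zero_iff] at h
    refine hS x ?_
    rw [← reOp_add_imOp S, add_apply, smul_apply, hx, h, smul_zero, add_zero]
  obtain ⟨W, hW, hn⟩ := exists_eq_mul_of_norm_le
    (denseRange_of_star_injective (by rwa [star_reOp])) zero_le_one hle
  exact ⟨W, hinj, hW, hn⟩

namespace ImFactor

variable {S W : H →L[ℂ] H}

theorem star_imFactor (h : ImFactor S W) : ImFactor (star S) (-W) where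
  injective := by rw [reOp_star]; exact h.injective
  im_eq := by rw [reOp_star, imOp_star, h.im_eq, neg_mul]
  norm_le := by rw [norm_neg]; exact h.norm_le

theorem im_eq' (h : ImFactor S W) : imOp S = reOp S * star W := by
  rw [← star_imOp, h.im_eq, star_mul, star_reOp]

theorem eq_left (h : ImFactor S W) : S = (1 + Complex.I • W) * reOp S := by
  nth_rw 1 [← reOp_add_imOp S]
  rw [h.im_eq, add_mul, one_mul, smul_mul_assoc]

theorem eq_right (h : ImFactor S W) : S = reOp S * (1 + Complex.I • star W) := by
  nth_rw 1 [← reOp_add_imOp S]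
  rw [h.im_eq', mul_add, mul_one, mul_smul_comm]

theorem star_eq_right (h : ImFactor S W) : star S = reOp S * (1 - Complex.I • star W) := by
  have := h.star_imFactor.eq_right
  rwa [reOp_star, star_neg, smul_neg, ← sub_eq_add_neg] at this

/-- As S = R(1 + iW*) with R injective, solving Sf = Rg amounts to solving (1 + iW*)f = g. -/
theorem range_one_add_iff (h : ImFactor S W) :
    (1 + Complex.I • star W).range = ⊤ ↔ (reOp S).range ≤ S.range := by
  rw [LinearMap.range_eq_top]
  constructor
  · rintro hs _ ⟨g, rfl⟩
    obtain ⟨f, rfl⟩ := hs g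
    exact ⟨f, DFunLike.congr_fun h.eq_right f⟩
  · intro hr g
    obtain ⟨f, hf⟩ := hr ⟨g, rfl⟩
    refine ⟨f, eq_of_apply_eq h.injective (Eq.trans ?_ hf)⟩
    exact (DFunLike.congr_fun h.eq_right f).symm

theorem range_one_sub_iff (h : ImFactor S W) :
    (1 - Complex.I • star W).range = ⊤ ↔ (reOp S).range ≤ (star S).range := by
  have := h.star_imFactor.range_one_add_iff
  rwa [star_neg, smul_neg, ← sub_eq_add_neg, reOp_star] at this

end ImFactor

/-! ### The operator Z and the equivalences in the accretive case -/

omit [CompleteSpace H] in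
theorem range_one_sub_sq_iff (Z : H →L[ℂ] H) :
    (1 - Z * Z).range = ⊤ ↔ (1 + Z).range = ⊤ ∧ (1 - Z).range = ⊤ := by
  have h1 : 1 - Z * Z = (1 + Z) * (1 - Z) := by noncomm_ring
  have h2 : 1 - Z * Z = (1 - Z) * (1 + Z) := by noncomm_ring
  simp only [LinearMap.range_eq_top]
  constructor
  · intro h
    exact ⟨fun y => (h y).imp' (⇑(1 - Z)) fun x hx => by rw [← hx, h1]; rfl,
      fun y => (h y).imp' (⇑(1 + Z)) fun x hx => by rw [← hx, h2]; rfl⟩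
  · rintro ⟨ha, hb⟩
    rw [h1]
    exact ha.comp hb

/-- From Im S = R W* the range of Im S lies in the domain of R⁻¹, so Z is everywhere defined and
bounded. -/
theorem opZ_eq {B : H →ₗ.[ℂ] H} {W : H →L[ℂ] H} (h : ImFactor (invSqrt B) W) :
    opZ B = ofBounded (Complex.I • star W) := by
  have : opMul (ofBounded (reOp (invSqrt B))).inverse (ofBounded (imOp (invSqrt B))) =
      ofBounded (star W) := by
    refine LinearPMap.eq_of_eq_graph (Submodule.ext fun ⟨x, z⟩ => ?_)
    simp only [mem_graph_opMul, mem_graph_ofBounded, exists_eq_left', mem_graph_inverse h.injective]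
    rw [h.im_eq', mul_apply_eq_comp]
    exact ⟨fun hz => (eq_of_apply_eq h.injective hz).symm, fun hz => by rw [hz]⟩
  rw [opZ, this]
  rfl

theorem tfae_range_eq {A : H →ₗ.[ℂ] H} {S W : H →L[ℂ] H} (hA : IsBoundedInverse A S)
    (hS' : ∀ x, star S x = 0 → x = 0) (h : ImFactor S W) :
    List.TFAE [
      S.range = (star S).range,
      IsBoundedOp (opMul A (ofBounded (star S))) ∧ HasBoundedInverse (opMul A (ofBounded (star S))),
      (1 + Complex.I • star W).range = ⊤ ∧ (1 - Complex.I • star W).range = ⊤,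
      (1 - (Complex.I • star W) * (Complex.I • star W)).range = ⊤,
      (reOp S).range ≤ S.range ⊓ (star S).range] := by
  have hS : ∀ x, S x = 0 → x = 0 := fun x hx => hA.eq_zero hx
  have hC : ∀ x y, (x, y) ∈ (opMul A (ofBounded (star S))).graph ↔ S y = star S x := fun x y => by
    simp only [mem_graph_opMul, mem_graph_ofBounded, exists_eq_left', hA.mem_graph]
  tfae_have 1 → 2 := by
    intro hr
    obtain ⟨X, hX⟩ := exists_eq_mul_of_range_le hS hr.ge
    obtain ⟨Y, hY⟩ := exists_eq_mul_of_range_le hS' hr.le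
    constructor
    · have : opMul A (ofBounded (star S)) = ofBounded X := by
        refine LinearPMap.eq_of_eq_graph (Submodule.ext fun ⟨x, z⟩ => ?_)
        rw [hC, mem_graph_ofBounded, hX, mul_apply_eq_comp]
        exact ⟨fun hz => (eq_of_apply_eq hS hz).symm, fun hz => by rw [hz]⟩
      rw [IsBoundedOp, this, opNorm_ofBounded]
      exact enorm_lt_top
    · refine ⟨Y, isBoundedInverse_iff.mpr fun x y => ?_⟩
      rw [hC, DFunLike.congr_fun hY y, mul_apply_eq_comp]
      exact ⟨eq_of_apply_eq hS', fun hz => by rw [hz]⟩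
  tfae_have 2 → 3 := by
    rintro ⟨hb, T, hT⟩
    obtain ⟨M, hM0, hM⟩ := exists_norm_le_of_isBoundedOp hb
    set Z := Complex.I • star W with hZ
    have hZn : ‖Z‖ ≤ 1 := by
      rw [hZ, norm_smul, Complex.norm_I, one_mul, norm_star]
      exact h.norm_le
    -- T inverts S⁻¹S*, so S = S*T; the factor R is cancelled on the left.
    have h1 : 1 + Z = (1 - Z) * T := by
      refine eq_of_mul_eq_mul h.injective ?_
      rw [← h.eq_right, ← mul_assoc, ← h.star_eq_right]
      ext y
      exact (hC _ _).mp ((hT.mem_graph _ _).mpr rfl)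
    -- Adding 1 - Z to both sides of `h1` gives 2 = (1 - Z)(T + 1), so 1 - Z is onto.
    have h2 : ∀ y, (1 - Z) ((1 / 2 : ℂ) • (T + 1) y) = y := fun y => by
      rw [map_smul, ← mul_apply_eq_comp, mul_add, ← h1, mul_one, add_add_sub_cancel, add_apply,
        one_apply_eq_self, ← two_smul ℂ, smul_smul]
      norm_num
    have hu : IsUnit (1 - Z) := by
      rw [ContinuousLinearMap.isUnit_iff_bijective]
      refine ⟨fun x y hxy => eq_of_apply_eq hS' ?_, fun y => ⟨_, h2 y⟩⟩
      rw [h.star_eq_right, mul_apply_eq_comp, mul_apply_eq_comp, hxy]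
    obtain ⟨c, hc, hcZ⟩ := exists_norm_le_of_isUnit hu
    have hu' : IsUnit (1 + Z) := by
      -- Here c bounds 1 - Z from below, and ‖y‖ ≤ M‖Ty‖ because y is the image of Ty under the
      -- bounded operator S⁻¹S*.
      refine isUnit_one_add_of_norm_le hZn (c := c / (M + 1)) (by positivity) fun y => ?_
      rw [div_mul_eq_mul_div, div_le_iff₀ (by positivity), h1, mul_apply_eq_comp]
      have h3 := hcZ (T y)
      have h4 := hM _ _ ((hT.mem_graph (T y) y).mpr rfl)
      nlinarith [norm_nonneg ((1 - Z) (T y)), norm_nonneg (T y)]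
    exact ⟨LinearMap.range_eq_top.mpr (ContinuousLinearMap.isUnit_iff_bijective.mp hu').2,
      LinearMap.range_eq_top.mpr (ContinuousLinearMap.isUnit_iff_bijective.mp hu).2⟩
  tfae_have 4 ↔ 3 := range_one_sub_sq_iff _
  tfae_have 3 ↔ 5 := by
    rw [h.range_one_add_iff, h.range_one_sub_iff, le_inf_iff]
  tfae_have 5 → 1 := by
    intro hr
    -- If ran R lies in both ranges, then Sf = 2Rf - S*f lies in ran S*, and symmetrically.
    have hs : ∀ f, S f + star S f = reOp S ((2 : ℂ) • f) := fun f => by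
      rw [map_smul, reOp, smul_apply, smul_smul, ← ContinuousLinearMap.star_eq_adjoint, add_apply]
      norm_num
    refine le_antisymm ?_ ?_
    · rintro _ ⟨f, rfl⟩
      have := (star S).range.sub_mem (hr ⟨(2 : ℂ) • f, rfl⟩).2 ⟨f, rfl⟩
      change reOp S ((2 : ℂ) • f) - star S f ∈ _ at this
      rwa [← hs, add_sub_cancel_right] at this
    · rintro _ ⟨f, rfl⟩
      have := S.range.sub_mem (hr ⟨(2 : ℂ) • f, rfl⟩).1 ⟨f, rfl⟩
      change reOp S ((2 : ℂ) • f) - S f ∈ _ at this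
      rwa [← hs, add_sub_cancel_left] at this
  tfae_finish

end

section

variable {H : Type*} [NormedAddCommGroup H] [InnerProductSpace ℂ H]

/-! ### Sectorial forms -/

section

variable {E : Type*} [AddCommGroup E] [Module ℂ E] {t : E →ₗ[ℂ] E →ₗ⋆[ℂ] ℂ} {k : ℝ}

theorem four_mul_form (t : E →ₗ[ℂ] E →ₗ⋆[ℂ] ℂ) (u v : E) :
    4 * t u v = t (u + v) (u + v) - t (u - v) (u - v) +
      Complex.I * t (u + Complex.I • v) (u + Complex.I • v) -
      Complex.I * t (u - Complex.I • v) (u - Complex.I • v) := by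
  simp only [map_add, map_sub, LinearMap.add_apply, LinearMap.sub_apply, map_smul, map_smulₛₗ,
    LinearMap.smul_apply, smul_eq_mul, Complex.conj_I]
  linear_combination (2 * t u v - 2 * t v u) * Complex.I_mul_I

theorem form_parallelogram (t : E →ₗ[ℂ] E →ₗ⋆[ℂ] ℂ) (u v : E) :
    t (u + v) (u + v) + t (u - v) (u - v) = 2 * (t u u + t v v) := by
  simp only [map_add, map_sub, LinearMap.add_apply, LinearMap.sub_apply]
  ring

/-- Cauchy–Schwarz for sectorial forms. Polarization and the parallelogram law bound |t(u, v)| by (1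
+ k)(Re t(u, u) + Re t(v, v)); scaling u then yields the product form. -/
theorem norm_form_sq_le
    (ht : ∀ u, 0 ≤ (t u u).re ∧ |(t u u).im| ≤ k * (t u u).re) (u v : E) :
    ‖t u v‖ ^ 2 ≤ (2 * (1 + k)) ^ 2 * ((t u u).re * (t v v).re) := by
  have h1 : ∀ w, ‖t w w‖ ≤ (1 + k) * (t w w).re := fun w => by
    refine (Complex.norm_le_abs_re_add_abs_im _).trans ?_
    rw [abs_of_nonneg (ht w).1]
    linarith [(ht w).2]
  have h2 : ∀ u v, ‖t u v‖ ≤ (1 + k) * ((t u u).re + (t v v).re) := fun u v => by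
    have hI : (t (Complex.I • v) (Complex.I • v)) = t v v := by
      simp only [map_smul, map_smulₛₗ, LinearMap.smul_apply, smul_eq_mul, Complex.conj_I]
      linear_combination (-t v v) * Complex.I_mul_I
    have e1 := congrArg Complex.re (form_parallelogram t u v)
    have e2 := congrArg Complex.re (form_parallelogram t u (Complex.I • v))
    rw [hI] at e2
    have e3 := congrArg norm (four_mul_form t u v)
    have e4 := (norm_sub_le (t (u + v) (u + v) - t (u - v) (u - v) +
      Complex.I * t (u + Complex.I • v) (u + Complex.I • v))
      (Complex.I * t (u - Complex.I • v) (u - Complex.I • v)))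
    have e5 := norm_add_le (t (u + v) (u + v) - t (u - v) (u - v))
      (Complex.I * t (u + Complex.I • v) (u + Complex.I • v))
    have e6 := norm_sub_le (t (u + v) (u + v)) (t (u - v) (u - v))
    rw [← e3, norm_mul] at e4
    simp only [norm_mul, Complex.norm_I, one_mul, Complex.norm_ofNat] at e4 e5
    have r2 : ∀ z : ℂ, (2 * z).re = 2 * z.re := fun z => by simp
    rw [r2, Complex.add_re, Complex.add_re] at e1 e2
    have i1 := h1 (u + v)
    have i2 := h1 (u - v)
    have i3 := h1 (u + Complex.I • v)
    have i4 := h1 (u - Complex.I • v)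
    have e7 : (1 + k) * ((t (u + v) (u + v)).re + (t (u - v) (u - v)).re +
        ((t (u + Complex.I • v) (u + Complex.I • v)).re +
          (t (u - Complex.I • v) (u - Complex.I • v)).re)) =
        (1 + k) * (2 * ((t u u).re + (t v v).re) + 2 * ((t u u).re + (t v v).re)) := by
      rw [e1, e2]
    linarith
  -- The vector u is replaced by xu; the nonpositive discriminant gives the constant 2(1 + k).
  have h3 : ∀ x : ℝ, 0 ≤ ((1 + k) * (t u u).re) * (x * x) + (-‖t u v‖) * x +
      (1 + k) * (t v v).re := fun x => by
    have h := h2 ((x : ℂ) • u) v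
    simp only [map_smul, map_smulₛₗ, LinearMap.smul_apply, smul_eq_mul, norm_mul,
      Complex.norm_real, Complex.conj_ofReal, Complex.re_ofReal_mul, Real.norm_eq_abs] at h
    nlinarith [le_abs_self x, norm_nonneg (t u v)]
  have h4 := discrim_le_zero h3
  rw [discrim] at h4
  nlinarith

end

/-- The sesquilinear form `(K f, g)`. -/
def opForm (K : H →L[ℂ] H) : H →ₗ[ℂ] H →ₗ⋆[ℂ] ℂ := (innerₛₗ ℂ (E := H)).flip.comp K.toLinearMap

theorem opForm_apply (K : H →L[ℂ] H) (f g : H) : opForm K f g = inner ℂ g (K f) := rfl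

/-- `|Im (K f, f)| ≤ k Re (K f, f)` for all `f`, for a bounded operator `K`. -/
def IsBoundedSectorial (K : H →L[ℂ] H) (k : ℝ) : Prop :=
  ∀ f : H, |(inner ℂ f (K f)).im| ≤ k * (inner ℂ f (K f)).re

variable [CompleteSpace H]

/-- `P` is a selfadjoint square root of `Re K`. -/
structure IsReSqrt (K P : H →L[ℂ] H) : Prop where
  star_eq : star P = P
  mul_self : P * P = reOp K

theorem IsReSqrt.norm_sq {K P : H →L[ℂ] H} (hP : IsReSqrt K P) (f : H) :
    ‖P f‖ ^ 2 = (inner ℂ f (K f)).re := by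
  have h := inner_reOp_self K f
  rw [← hP.mul_self, mul_apply_eq_comp, ← star_inner_apply, hP.star_eq,
    inner_self_eq_norm_sq_to_K] at h
  refine Complex.ofReal_injective (Eq.trans ?_ h)
  push_cast
  rfl

theorem IsReSqrt.norm_inner_le {K P : H →L[ℂ] H} (hP : IsReSqrt K P) {k : ℝ} (hk : 0 ≤ k)
    (hK : IsBoundedSectorial K k) (f g : H) :
    ‖inner ℂ g (K f)‖ ≤ 2 * (1 + k) * (‖P f‖ * ‖P g‖) := by
  have h := norm_form_sq_le (t := opForm K)
    (fun u => ⟨by rw [opForm_apply, ← hP.norm_sq]; positivity, hK u⟩) f g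
  rw [opForm_apply, opForm_apply, opForm_apply, ← hP.norm_sq, ← hP.norm_sq, ← mul_pow,
    ← mul_pow] at h
  exact le_of_sq_le_sq h (by positivity)

theorem IsReSqrt.injective {K P : H →L[ℂ] H} (hP : IsReSqrt K P) {k : ℝ} (hk : 0 ≤ k)
    (hK : IsBoundedSectorial K k) (hinj : ∀ x, K x = 0 → x = 0) (x : H) (hx : P x = 0) :
    x = 0 := by
  refine hinj x (inner_self_eq_zero.mp (norm_le_zero_iff.mp
    ((hP.norm_inner_le hk hK x (K x)).trans_eq ?_)))
  rw [hx, norm_zero, zero_mul, mul_zero]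

-- By density the estimate holds with any vector in place of Cg, in particular with x itself.
omit [CompleteSpace H] in
theorem norm_le_of_norm_inner_le {C : H →L[ℂ] H} (hC : DenseRange C) {x : H} {c : ℝ} (hc : 0 ≤ c)
    (h : ∀ g, ‖inner ℂ (C g) x‖ ≤ c * ‖C g‖) : ‖x‖ ≤ c := by
  have h' : ∀ y, ‖inner ℂ y x‖ ≤ c * ‖y‖ := fun y =>
    hC.induction_on (p := fun y => ‖inner ℂ y x‖ ≤ c * ‖y‖) y
      (isClosed_le (by fun_prop) (by fun_prop)) h
  have := h' x
  rw [inner_self_eq_norm_sq_to_K, norm_pow, RCLike.norm_ofReal, abs_norm, sq] at this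
  rcases eq_or_lt_of_le (norm_nonneg x) with h0 | h0
  · rwa [← h0]
  · exact le_of_mul_le_mul_right this h0

/-- If `ran P ⊆ ran S`, then `ran S* ⊆ ran P`. -/
theorem IsReSqrt.range_star_le {S P : H →L[ℂ] H} (hP : IsReSqrt (S * S) P) {k : ℝ} (hk : 0 ≤ k)
    (hK : IsBoundedSectorial (S * S) k) (hS : ∀ x, S x = 0 → x = 0)
    (hle : P.range ≤ S.range) : (star S).range ≤ P.range := by
  obtain ⟨c, hc, h⟩ := norm_star_le_of_range_le hS hle
  have hinj : ∀ x, (S * S) x = 0 → x = 0 := fun x hx => hS _ (hS _ hx)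
  refine range_le_of_norm_star_le (hP.injective hk hK hinj) (c := 2 * (1 + k) * c)
    (by positivity) fun f => ?_
  rw [star_star, hP.star_eq]
  rw [hP.star_eq] at h
  -- Sf is tested against the dense set of vectors S*g, where (Sf, S*g) = (S²f, g) and ‖Pg‖ ≤
  -- c‖S*g‖.
  refine norm_le_of_norm_inner_le (C := star S)
    (denseRange_of_star_injective (by rwa [star_star])) (by positivity) fun g => ?_
  rw [star_inner_apply]
  calc ‖inner ℂ g ((S * S) f)‖ ≤ 2 * (1 + k) * (‖P f‖ * ‖P g‖) := hP.norm_inner_le hk hK f g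
    _ ≤ 2 * (1 + k) * (‖P f‖ * (c * ‖star S g‖)) := by gcongr; exact h g
    _ = _ := by ring

protected theorem IsReSqrt.star {K P : H →L[ℂ] H} (hP : IsReSqrt K P) : IsReSqrt (star K) P :=
  ⟨hP.star_eq, by rw [reOp_star, hP.mul_self]⟩

protected theorem IsBoundedSectorial.star {K : H →L[ℂ] H} {k : ℝ} (hK : IsBoundedSectorial K k) :
    IsBoundedSectorial (star K) k := fun f => by
  have h : inner ℂ f (star K f) = starRingEnd ℂ (inner ℂ f (K f)) := by
    rw [inner_star_apply, inner_conj_symm]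
  rw [h, Complex.conj_im, Complex.conj_re, abs_neg]
  exact hK f

/-! ### The equivalences in the sectorial case -/

theorem bddAbove_range_div_iff {ι : Type*} {a b : ι → ℝ} (hb : ∀ i, 0 < b i) :
    BddAbove (Set.range fun i => a i / b i) ↔ ∃ c : ℝ, 0 ≤ c ∧ ∀ i, a i ≤ c * b i := by
  constructor
  · rintro ⟨c, hc⟩
    refine ⟨max c 0, le_max_right _ _, fun i => ?_⟩
    rw [← div_le_iff₀ (hb i)]
    exact (hc ⟨i, rfl⟩).trans (le_max_left _ _)
  · rintro ⟨c, -, hc⟩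
    refine ⟨c, ?_⟩
    rintro _ ⟨i, rfl⟩
    exact (div_le_iff₀ (hb i)).mpr (hc i)

/-- Because ‖Pf‖² = ‖Rf‖² - ‖WRf‖² and R has dense range, the estimate says that ‖Wg‖² stays below a
fixed fraction of ‖g‖². -/
theorem ImFactor.norm_lt_one_iff {S W P : H →L[ℂ] H} (h : ImFactor S W)
    (hP : IsReSqrt (S * S) P) :
    ‖W‖ < 1 ↔ ∃ c : ℝ, 0 ≤ c ∧ ∀ f, ‖reOp S f‖ ^ 2 ≤ c * ‖P f‖ ^ 2 := by
  have hPf : ∀ f, ‖P f‖ ^ 2 = ‖reOp S f‖ ^ 2 - ‖W (reOp S f)‖ ^ 2 := fun f => by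
    rw [hP.norm_sq, inner_mul_self_re, h.im_eq, mul_apply_eq_comp]
  constructor
  · intro hW
    have h1 : 0 < 1 - ‖W‖ ^ 2 := by nlinarith [norm_nonneg W]
    refine ⟨(1 - ‖W‖ ^ 2)⁻¹, by positivity, fun f => ?_⟩
    rw [le_inv_mul_iff₀ h1, hPf]
    have h2 : ‖W (reOp S f)‖ ^ 2 ≤ (‖W‖ * ‖reOp S f‖) ^ 2 := by gcongr; exact W.le_opNorm _
    rw [mul_pow] at h2
    linarith
  · rintro ⟨c, hc, hle⟩
    have h0 : (0 : ℝ) ≤ 1 - (c + 1)⁻¹ := by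
      rw [sub_nonneg]; exact inv_le_one_of_one_le₀ (by linarith)
    have h1 : ∀ g, ‖W g‖ ^ 2 ≤ (1 - (c + 1)⁻¹) * ‖g‖ ^ 2 := fun g =>
      (denseRange_of_star_injective (C := reOp S) (by rw [star_reOp]; exact h.injective)).induction_on
        (p := fun g => ‖W g‖ ^ 2 ≤ (1 - (c + 1)⁻¹) * ‖g‖ ^ 2) g
        (isClosed_le (by fun_prop) (by fun_prop)) fun f => by
          have h2 : (c + 1)⁻¹ * ‖reOp S f‖ ^ 2 ≤ ‖P f‖ ^ 2 := by
            rw [inv_mul_le_iff₀ (by positivity)]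
            nlinarith [hle f, sq_nonneg ‖P f‖]
          rw [hPf] at h2
          linarith
    have h2 : ‖W‖ ≤ √(1 - (c + 1)⁻¹) := W.opNorm_le_bound (Real.sqrt_nonneg _) fun g => by
      refine le_of_sq_le_sq ?_ (by positivity)
      rw [mul_pow, Real.sq_sqrt h0]
      exact h1 g
    refine h2.trans_lt ?_
    rw [Real.sqrt_lt' one_pos, one_pow]
    linarith [inv_pos.mpr (by linarith : (0 : ℝ) < c + 1)]

theorem ImFactor.norm_im_le {S W : H →L[ℂ] H} (h : ImFactor S W) (f : H) :
    ‖imOp S f‖ ≤ ‖reOp S f‖ := by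
  rw [h.im_eq, mul_apply_eq_comp]
  exact (W.le_of_opNorm_le h.norm_le _).trans_eq (one_mul _)

/-- The hub is ran R = ran P. Each of the range conditions 1, 2, 3, 5 implies 4 by
`IsReSqrt.range_star_le`, and 4 gives the hub since R = (S + S*)/2; conversely ‖W‖ < 1 makes 1 ± iW*
invertible, so S, S* and R share one range. -/
theorem tfae_range_eq_of_sectorial {S W P : H →L[ℂ] H} (h : ImFactor S W)
    (hS : ∀ x, S x = 0 → x = 0) (hS' : ∀ x, star S x = 0 → x = 0)
    (hP : IsReSqrt (S * S) P) {k : ℝ} (hk : 0 ≤ k) (hK : IsBoundedSectorial (S * S) k) :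
    List.TFAE [
      S.range = (star S).range,
      S.range = P.range,
      (star S).range = P.range,
      S.range ≤ P.range ∧ (star S).range ≤ P.range,
      P.range ≤ S.range ⊓ (star S).range,
      ‖W‖ < 1,
      BddAbove (Set.range fun f : {f : H // f ≠ 0} =>
        ‖reOp S f‖ ^ 2 / (inner ℂ (f : H) ((S * S) f)).re),
      BddAbove (Set.range fun f : {f : H // f ≠ 0} =>
        (‖star S f‖ ^ 2 + ‖S f‖ ^ 2) / (inner ℂ (f : H) ((S * S) f)).re),
      (reOp S).range = P.range] := by
  have hPinj := hP.injective hk hK fun x hx => hS _ (hS _ hx)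
  have hPR : P.range ≤ (reOp S).range := by
    refine range_le_of_norm_star_le h.injective zero_le_one fun f => ?_
    rw [hP.star_eq, star_reOp, one_mul]
    refine le_of_sq_le_sq ?_ (norm_nonneg _)
    rw [hP.norm_sq, inner_mul_self_re]
    linarith [sq_nonneg ‖imOp S f‖]
  have h1 : P.range ≤ S.range → (star S).range ≤ P.range := hP.range_star_le hk hK hS
  -- The same argument for S*, whose square K* has the same real part and sector as K.
  have h2 : P.range ≤ (star S).range → S.range ≤ P.range := by
    have hP' := hP.star
    have hK' := hK.star
    rw [star_mul] at hP' hK'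
    have := hP'.range_star_le hk hK' hS'
    rwa [star_star] at this
  have hSR : S.range ≤ (reOp S).range := by
    nth_rw 1 [h.eq_right]
    rintro _ ⟨f, rfl⟩
    exact ⟨_, rfl⟩
  have hSR' : (star S).range ≤ (reOp S).range := by
    nth_rw 1 [h.star_eq_right]
    rintro _ ⟨f, rfl⟩
    exact ⟨_, rfl⟩
  have hRS : ∀ f, reOp S f = (1 / 2 : ℂ) • (S f + star S f) := fun f => by
    rw [reOp, smul_apply, ← ContinuousLinearMap.star_eq_adjoint, add_apply]
  have hpos : ∀ f : {f : H // f ≠ 0}, 0 < (inner ℂ (f : H) ((S * S) f)).re := fun f => by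
    rw [← hP.norm_sq]
    exact pow_pos (norm_pos_iff.mpr fun h0 => f.2 (hPinj _ h0)) 2
  have hsub : ∀ {a : H → ℝ} {c : ℝ}, a 0 = 0 →
      (∀ f : {f : H // f ≠ 0}, a f ≤ c * (inner ℂ (f : H) ((S * S) f)).re) →
      ∀ f, a f ≤ c * ‖P f‖ ^ 2 := fun {a c} ha hf f => by
    rcases eq_or_ne f 0 with rfl | h0
    · simp [ha]
    · rw [hP.norm_sq]; exact hf ⟨f, h0⟩
  have hunit : ‖W‖ < 1 → (reOp S).range ≤ S.range ∧ (reOp S).range ≤ (star S).range := fun hW => by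
    rw [← h.range_one_add_iff, ← h.range_one_sub_iff]
    have hn : ‖Complex.I • star W‖ < 1 := by
      rwa [norm_smul, Complex.norm_I, one_mul, norm_star]
    constructor
    · have := (Units.oneSub (-(Complex.I • star W)) (by rwa [norm_neg])).isUnit
      rw [Units.val_oneSub, sub_neg_eq_add] at this
      exact LinearMap.range_eq_top.mpr (ContinuousLinearMap.isUnit_iff_bijective.mp this).2
    · exact LinearMap.range_eq_top.mpr (ContinuousLinearMap.isUnit_iff_bijective.mp
        (Units.oneSub (Complex.I • star W) hn).isUnit).2
  have hG : (∃ c : ℝ, 0 ≤ c ∧ ∀ f, ‖reOp S f‖ ^ 2 ≤ c * ‖P f‖ ^ 2) ↔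
      (reOp S).range = P.range := by
    constructor
    · rintro ⟨c, hc, hle⟩
      refine le_antisymm (range_le_of_norm_star_le hPinj (Real.sqrt_nonneg c) fun f => ?_) hPR
      rw [hP.star_eq, star_reOp]
      refine le_of_sq_le_sq ?_ (by positivity)
      rw [mul_pow, Real.sq_sqrt hc]
      exact hle f
    · intro hr
      obtain ⟨c, hc, hle⟩ := norm_star_le_of_range_le hPinj hr.le
      refine ⟨c ^ 2, sq_nonneg c, fun f => ?_⟩
      rw [← mul_pow]
      have := hle f
      rw [hP.star_eq, star_reOp] at this
      gcongr
  tfae_have 1 → 4 := fun hr => by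
    have hR : (reOp S).range ≤ S.range := by
      rintro _ ⟨f, rfl⟩
      change reOp S f ∈ _
      rw [hRS]
      exact S.range.smul_mem _ (S.range.add_mem ⟨f, rfl⟩ (hr ▸ ⟨f, rfl⟩))
    exact ⟨h2 (hPR.trans (hR.trans hr.le)), h1 (hPR.trans hR)⟩
  tfae_have 2 → 4 := fun hr => ⟨hr.le, h1 hr.ge⟩
  tfae_have 3 → 4 := fun hr => ⟨h2 hr.ge, hr.le⟩
  tfae_have 5 → 4 := fun hr => ⟨h2 (hr.trans inf_le_right), h1 (hr.trans inf_le_left)⟩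
  tfae_have 4 → 9 := fun hr => by
    refine le_antisymm ?_ hPR
    rintro _ ⟨f, rfl⟩
    change reOp S f ∈ _
    rw [hRS]
    exact P.range.smul_mem _ (P.range.add_mem (hr.1 ⟨f, rfl⟩) (hr.2 ⟨f, rfl⟩))
  tfae_have 6 ↔ 9 := (h.norm_lt_one_iff hP).trans hG
  tfae_have 7 ↔ 9 := by
    rw [bddAbove_range_div_iff hpos, ← hG]
    exact ⟨fun ⟨c, hc, hle⟩ => ⟨c, hc, hsub (by simp) hle⟩,
      fun ⟨c, hc, hle⟩ => ⟨c, hc, fun f => by rw [← hP.norm_sq]; exact hle f⟩⟩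
  tfae_have 8 ↔ 9 := by
    rw [bddAbove_range_div_iff hpos, ← hG]
    constructor
    · rintro ⟨c, hc, hle⟩
      refine ⟨c, hc, hsub (by simp) fun f => le_trans ?_ (hle f)⟩
      rw [norm_sq_add_norm_star_sq]
      nlinarith [sq_nonneg ‖reOp S f‖, sq_nonneg ‖imOp S f‖]
    · rintro ⟨c, hc, hle⟩
      -- The sum of squares is 2(‖Rf‖² + ‖Jf‖²) ≤ 4‖Rf‖².
      refine ⟨4 * c, by positivity, fun f => ?_⟩
      rw [norm_sq_add_norm_star_sq, ← hP.norm_sq]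
      have := pow_le_pow_left₀ (norm_nonneg _) (h.norm_im_le f) 2
      linarith [hle f]
  tfae_have 6 → 1 := fun hW =>
    le_antisymm (hSR.trans (hunit hW).2) (hSR'.trans (hunit hW).1)
  tfae_have 6 → 2 := fun hW => by
    rw [← ((h.norm_lt_one_iff hP).trans hG).mp hW]
    exact le_antisymm hSR (hunit hW).1
  tfae_have 6 → 3 := fun hW => by
    rw [← ((h.norm_lt_one_iff hP).trans hG).mp hW]
    exact le_antisymm hSR' (hunit hW).2
  tfae_have 6 → 5 := fun hW => hPR.trans (le_inf (hunit hW).1 (hunit hW).2)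
  tfae_finish

end

section

variable {H : Type*} [NormedAddCommGroup H] [InnerProductSpace ℂ H] [CompleteSpace H]

open Filter Topology

/-! ### The form of an `m`-sectorial operator -/

/-- The factorization `K = P Q P` with `P` selfadjoint and injective and `Re Q = I`. -/
structure SectorialFactor (K P Q : H →L[ℂ] H) : Prop where
  star_eq : star P = P
  injective : ∀ x, P x = 0 → x = 0
  eq_mul : K = P * (Q * P)
  reOp_eq : reOp Q = 1

/-- The bound |(Kf, g)| ≤ C‖Pf‖‖Pg‖ is used twice: it splits P off on the left of K (via K*), then
off the right of the remaining factor. -/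
theorem IsReSqrt.exists_sectorialFactor {K P : H →L[ℂ] H} (hP : IsReSqrt K P) {k : ℝ} (hk : 0 ≤ k)
    (hK : IsBoundedSectorial K k) (hinj : ∀ x, K x = 0 → x = 0) :
    ∃ Q, SectorialFactor K P Q := by
  have hPinj := hP.injective hk hK hinj
  have hPd : DenseRange P := denseRange_of_star_injective (by rwa [hP.star_eq])
  have hC := hP.norm_inner_le hk hK
  obtain ⟨D, hD, -⟩ := exists_eq_mul_of_norm_le (A := star K) hPd
    (c := 2 * (1 + k) * ‖P‖) (by positivity) fun g => by
      refine norm_le_of_norm_inner_le (C := 1) Function.surjective_id.denseRange (by positivity)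
        fun f => ?_
      rw [one_apply_eq_self, inner_star_apply, norm_inner_symm]
      calc ‖inner ℂ g (K f)‖ ≤ 2 * (1 + k) * (‖P f‖ * ‖P g‖) := hC f g
        _ ≤ 2 * (1 + k) * ((‖P‖ * ‖f‖) * ‖P g‖) := by gcongr; exact P.le_opNorm f
        _ = _ := by ring
  have hKD : K = P * star D := by
    rw [← star_star K, hD, star_mul, hP.star_eq]
  obtain ⟨Q, hQ, -⟩ := exists_eq_mul_of_norm_le (A := star D) hPd
    (c := 2 * (1 + k)) (by positivity) fun f => by
      refine norm_le_of_norm_inner_le hPd (by positivity) fun g => ?_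
      rw [← inner_star_apply, hP.star_eq, ← mul_apply_eq_comp, ← hKD]
      exact (hC f g).trans_eq (by ring)
  refine ⟨Q, hP.star_eq, hPinj, by rw [hKD, hQ], ?_⟩
  -- Both sides are Re K; cancelling P, taking adjoints and cancelling again leaves Re Q = I.
  have h1 : P * (reOp Q * P) = P * P := by
    rw [hP.mul_self, hKD, hQ, reOp, reOp, ← ContinuousLinearMap.star_eq_adjoint,
      ← ContinuousLinearMap.star_eq_adjoint, star_mul, star_mul, hP.star_eq]
    simp only [mul_smul_comm, smul_mul_assoc]
    noncomm_ring
  have h2 := congrArg star (eq_of_mul_eq_mul hPinj h1)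
  rw [star_mul, star_reOp, hP.star_eq] at h2
  exact eq_of_mul_eq_mul hPinj (by rw [h2, mul_one])

/-- With x = Qy, Re(Q⁻¹x, x) = Re(Qy, y) ≥ c‖y‖², and ‖x‖ ≤ ‖Q‖‖y‖. -/
theorem exists_re_inner_inverse_ge {Q : H →L[ℂ] H} {c : ℝ} (hc : 0 < c)
    (h : ∀ x, c * ‖x‖ ^ 2 ≤ (inner ℂ x (Q x)).re) :
    ∃ c', 0 < c' ∧ ∀ x, c' * ‖x‖ ^ 2 ≤ (inner ℂ x (Ring.inverse Q x)).re := by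
  refine ⟨c / (‖Q‖ ^ 2 + 1), by positivity, fun x => ?_⟩
  obtain ⟨y, rfl⟩ := (ContinuousLinearMap.isUnit_iff_bijective.mp (isUnit_of_coercive hc h)).2 x
  rw [← mul_apply_eq_comp, Ring.inverse_mul_cancel _ (isUnit_of_coercive hc h), one_apply_eq_self,
    ← inner_conj_symm, Complex.conj_re, div_mul_eq_mul_div, div_le_iff₀ (by positivity)]
  have h1 : ‖Q y‖ ^ 2 ≤ ‖Q‖ ^ 2 * ‖y‖ ^ 2 := by
    rw [← mul_pow]; gcongr; exact Q.le_opNorm y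
  nlinarith [h y, sq_nonneg ‖y‖, sq_nonneg ‖Q‖]

namespace SectorialFactor

variable {K P Q : H →L[ℂ] H}

theorem coercive (h : SectorialFactor K P Q) (x : H) : 1 * ‖x‖ ^ 2 ≤ (inner ℂ x (Q x)).re := by
  have h1 := inner_reOp_self Q x
  rw [h.reOp_eq, one_apply_eq_self, inner_self_eq_norm_sq_to_K] at h1
  rw [one_mul]
  refine le_of_eq (Complex.ofReal_injective (Eq.trans ?_ h1))
  push_cast
  rfl

theorem isUnit (h : SectorialFactor K P Q) : IsUnit Q := isUnit_of_coercive one_pos h.coercive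

theorem denseRange (h : SectorialFactor K P Q) : DenseRange (Q * P) := by
  have hPd : DenseRange P := denseRange_of_star_injective (by rw [h.star_eq]; exact h.injective)
  exact (ContinuousLinearMap.isUnit_iff_bijective.mp h.isUnit).2.denseRange.comp hPd Q.continuous

theorem inner_apply (h : SectorialFactor K P Q) (y f : H) :
    inner ℂ (P y) f = inner ℂ y (Ring.inverse Q ((Q * P) f)) := by
  rw [← mul_apply_eq_comp, ← mul_assoc, Ring.inverse_mul_cancel _ h.isUnit, one_mul,
    ← star_inner_apply, h.star_eq]

theorem apply_eq (h : SectorialFactor K P Q) (f : H) : K f = P ((Q * P) f) := by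
  rw [← mul_apply_eq_comp, ← h.eq_mul]

/-- The operator `P` as a linear equivalence onto its range. -/
def equivRange (h : SectorialFactor K P Q) : H ≃ₗ[ℂ] P.range :=
  LinearEquiv.ofInjective P.toLinearMap
    ((injective_iff_map_eq_zero P.toLinearMap).mpr h.injective)

/-- The closed form `a[P x, P y] = (Q⁻¹ x, y)` on `ran P`. -/
def toForm (h : SectorialFactor K P Q) : SesqForm H where
  domain := P.range
  form := LinearMap.mk₂'ₛₗ (RingHom.id ℂ) (starRingEnd ℂ)
    (fun u v => inner ℂ (h.equivRange.symm v) (Ring.inverse Q (h.equivRange.symm u)))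
    (fun u u' v => by simp only [map_add, inner_add_right])
    (fun c u v => by simp only [map_smul, inner_smul_right, RingHom.id_apply, smul_eq_mul])
    (fun u v v' => by simp only [map_add, inner_add_left])
    (fun c u v => by simp only [map_smul, inner_smul_left, smul_eq_mul])

/-- The operator `P` as a linear equivalence onto the domain of the form. -/
def equivDomain (h : SectorialFactor K P Q) : H ≃ₗ[ℂ] h.toForm.domain := h.equivRange

theorem coe_equivDomain (h : SectorialFactor K P Q) (x : H) : (h.equivDomain x : H) = P x := rfl

theorem toForm_apply (h : SectorialFactor K P Q) (x y : H) :
    h.toForm.form (h.equivDomain x) (h.equivDomain y) = inner ℂ y (Ring.inverse Q x) := by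
  change inner ℂ (h.equivRange.symm (h.equivRange y))
    (Ring.inverse Q (h.equivRange.symm (h.equivRange x))) = _
  rw [LinearEquiv.symm_apply_apply, LinearEquiv.symm_apply_apply]

theorem exists_re_inner_ge (h : SectorialFactor K P Q) :
    ∃ c, 0 < c ∧ ∀ x, c * ‖x‖ ^ 2 ≤ (inner ℂ x (Ring.inverse Q x)).re :=
  exists_re_inner_inverse_ge one_pos h.coercive

/-- A sequence whose values under the form `(Q⁻¹ x, x)` of the differences tend to zero is
convergent. -/
theorem exists_tendsto (h : SectorialFactor K P Q) {x : ℕ → H}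
    (hx : Tendsto (fun p : ℕ × ℕ => (inner ℂ (x p.1 - x p.2)
      (Ring.inverse Q (x p.1 - x p.2))).re) atTop (𝓝 0)) : ∃ y, Tendsto x atTop (𝓝 y) := by
  obtain ⟨c, hc, hle⟩ := h.exists_re_inner_ge
  refine cauchySeq_tendsto_of_complete (Metric.cauchySeq_iff.mpr fun ε hε => ?_)
  have h1 := hx.eventually (gt_mem_nhds (show 0 < c * ε ^ 2 by positivity))
  obtain ⟨⟨N, M⟩, hN⟩ := eventually_atTop.mp h1
  refine ⟨max N M, fun m hm n hn => ?_⟩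
  have h2 := hN (m, n) ⟨(le_max_left _ _).trans hm, (le_max_right _ _).trans hn⟩
  have h3 := (hle (x m - x n)).trans_lt h2
  rw [dist_eq_norm]
  exact lt_of_pow_lt_pow_left₀ 2 hε.le (lt_of_mul_lt_mul_left h3 hc.le)

omit [CompleteSpace H] in
theorem tendsto_form_zero {ι : Type*} {l : Filter ι} {z : ι → H} (hz : Tendsto z l (𝓝 0)) :
    Tendsto (fun i => inner ℂ (z i) (Ring.inverse Q (z i))) l (𝓝 0) := by
  have hc : Continuous fun x : H => inner ℂ x (Ring.inverse Q x) := by fun_prop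
  have := (hc.tendsto 0).comp hz
  simp only [inner_zero_left] at this
  exact this

omit [CompleteSpace H] in
theorem tendsto_form {x : ℕ → H} {y : H} (hx : Tendsto x atTop (𝓝 y)) :
    Tendsto (fun n => inner ℂ (x n - y) (Ring.inverse Q (x n - y))) atTop (𝓝 0) :=
  tendsto_form_zero (tendsto_sub_nhds_zero_iff.mpr hx)

/-- Coercivity of Q⁻¹ makes the form closed, and density of ran QP makes dom B = ran PQP a core. The
tangent of the semi-angle is ‖Q‖, since Re(Qy, y) = ‖y‖². -/
theorem toForm_isAssociated (h : SectorialFactor K P Q) {B : H →ₗ.[ℂ] H}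
    (hB : IsBoundedInverse B K) : h.toForm.IsAssociated B := by
  refine ⟨⟨Real.arctan ‖Q‖, Real.arctan_nonneg.mpr (norm_nonneg _), Real.arctan_lt_pi_div_two _,
    ?_⟩, ?_, ?_, ?_⟩
  · intro u
    obtain ⟨x, rfl⟩ := h.equivDomain.surjective u
    rw [h.toForm_apply, Real.tan_arctan]
    obtain ⟨y, rfl⟩ := (ContinuousLinearMap.isUnit_iff_bijective.mp h.isUnit).2 x
    rw [← mul_apply_eq_comp, Ring.inverse_mul_cancel _ h.isUnit, one_apply_eq_self,
      ← inner_conj_symm, Complex.conj_re, Complex.conj_im, abs_neg]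
    have h1 := h.coercive y
    rw [one_mul] at h1
    refine ⟨(sq_nonneg _).trans h1, (Complex.abs_im_le_norm _).trans ?_⟩
    calc ‖inner ℂ y (Q y)‖ ≤ ‖y‖ * ‖Q y‖ := norm_inner_le_norm _ _
      _ ≤ ‖y‖ * (‖Q‖ * ‖y‖) := by gcongr; exact Q.le_opNorm y
      _ = ‖Q‖ * ‖y‖ ^ 2 := by ring
      _ ≤ _ := by gcongr
  · intro u v hu hform
    obtain ⟨x, rfl⟩ : ∃ x : ℕ → H, u = fun n => h.equivDomain (x n) :=
      ⟨fun n => h.equivDomain.symm (u n), by simp⟩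
    simp only [← map_sub, h.toForm_apply, h.coe_equivDomain] at hform hu
    have hre := (Complex.continuous_re.tendsto _).comp hform
    rw [Complex.zero_re] at hre
    obtain ⟨y, hy⟩ := h.exists_tendsto hre
    obtain rfl : v = P y := tendsto_nhds_unique hu ((P.continuous.tendsto y).comp hy)
    refine ⟨(h.equivDomain y).2, ?_⟩
    change Tendsto (fun n => h.toForm.form (h.equivDomain (x n) - h.equivDomain y)
      (h.equivDomain (x n) - h.equivDomain y)) atTop (𝓝 0)
    simp only [← map_sub, h.toForm_apply]
    exact tendsto_form hy
  · intro u
    have hu : (u : H) = h.equivDomain ((Q * P) (B u)) := by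
      rw [h.coe_equivDomain, ← h.apply_eq, hB.2]
    refine ⟨hu ▸ (h.equivDomain _).2, fun v => ?_⟩
    obtain ⟨y, rfl⟩ := h.equivDomain.surjective v
    refine Eq.trans ?_ ((h.toForm_apply _ y).trans (h.inner_apply y (B u)).symm)
    exact congrArg (fun z => h.toForm.form z (h.equivDomain y)) (Subtype.ext hu)
  · intro u
    obtain ⟨x, rfl⟩ := h.equivDomain.surjective u
    obtain ⟨w, hw, hlim⟩ := mem_closure_iff_seq_limit.mp (h.denseRange x)
    choose f hf using hw
    refine ⟨fun n => h.equivDomain (w n), fun n => ?_, (P.continuous.tendsto x).comp hlim, ?_⟩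
    · rw [hB.domain_eq, h.coe_equivDomain, ← hf, ← h.apply_eq]
      exact ⟨f n, rfl⟩
    · simp only [← map_sub, h.toForm_apply]
      exact tendsto_form hlim

/-! ### Uniqueness of the form associated with B -/

section Associated

variable {B : H →ₗ.[ℂ] H} {a : SesqForm H}

theorem form_apply_of_mem (h : SectorialFactor K P Q) (hB : IsBoundedInverse B K)
    (ha : a.IsAssociated B) (f : H) :
    ∃ hu : P ((Q * P) f) ∈ a.domain, ∀ v : a.domain,
      a.form ⟨P ((Q * P) f), hu⟩ v = inner ℂ (v : H) f := by
  obtain ⟨u, hu, hf⟩ := (LinearPMap.mem_graph_iff _).mp (hB.1 f)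
  simp only at hu hf
  obtain ⟨hd, hv⟩ := ha.2.2.1 u
  rw [← h.apply_eq, ← hu]
  exact ⟨hd, fun v => by rw [hv, hf]⟩

theorem form_apply_self_of_mem (h : SectorialFactor K P Q) (hB : IsBoundedInverse B K)
    (ha : a.IsAssociated B) {x : H} (hx : x ∈ Set.range (Q * P)) (hu : P x ∈ a.domain) :
    a.form ⟨P x, hu⟩ ⟨P x, hu⟩ = inner ℂ x (Ring.inverse Q x) := by
  obtain ⟨f, rfl⟩ := hx
  obtain ⟨_, hv⟩ := h.form_apply_of_mem hB ha f
  rw [hv, h.inner_apply]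

/-- On dom B the form is determined by B. Approximating x by vectors of ran QP gives a form-Cauchy
sequence in dom B, and closedness puts Px into the domain. -/
theorem mem_domain (h : SectorialFactor K P Q) (hB : IsBoundedInverse B K)
    (ha : a.IsAssociated B) (x : H) : P x ∈ a.domain := by
  obtain ⟨w, hw, hlim⟩ := mem_closure_iff_seq_limit.mp (h.denseRange x)
  have hd : ∀ n, P (w n) ∈ a.domain := fun n => by
    obtain ⟨f, hf⟩ := hw n
    rw [← hf]
    exact (h.form_apply_of_mem hB ha f).1
  refine (ha.2.1 (fun n => ⟨P (w n), hd n⟩) (P x) ((P.continuous.tendsto x).comp hlim) ?_).1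
  have hsub : ∀ m n, a.form (⟨P (w m), hd m⟩ - ⟨P (w n), hd n⟩)
      (⟨P (w m), hd m⟩ - ⟨P (w n), hd n⟩) =
      inner ℂ (w m - w n) (Ring.inverse Q (w m - w n)) := fun m n => by
    have hmem : w m - w n ∈ Set.range (Q * P) := (Q * P).range.sub_mem (hw m) (hw n)
    have hP : P (w m - w n) ∈ a.domain := by rw [map_sub]; exact a.domain.sub_mem (hd m) (hd n)
    have he : (⟨P (w m), hd m⟩ - ⟨P (w n), hd n⟩ : a.domain) = ⟨P (w m - w n), hP⟩ :=
      Subtype.ext (map_sub P _ _).symm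
    rw [he, h.form_apply_self_of_mem hB ha hmem]
  simp only [hsub]
  have h1 : Tendsto (fun p : ℕ × ℕ => w p.1 - w p.2) atTop (𝓝 0) := by
    rw [← prod_atTop_atTop_eq, ← sub_self x]
    exact (hlim.comp tendsto_fst).sub (hlim.comp tendsto_snd)
  exact tendsto_form_zero h1

theorem form_sub_apply_self (h : SectorialFactor K P Q) (hB : IsBoundedInverse B K)
    (ha : a.IsAssociated B) {v w : a.domain} {f g : H} (hv : (v : H) = P ((Q * P) f))
    (hw : (w : H) = P ((Q * P) g)) :
    a.form (v - w) (v - w) =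
      inner ℂ ((Q * P) f - (Q * P) g) (Ring.inverse Q ((Q * P) f - (Q * P) g)) := by
  have hvw : ((v - w : a.domain) : H) = P ((Q * P) f - (Q * P) g) := by
    rw [Submodule.coe_sub, hv, hw, ← map_sub]
  have hmem : P ((Q * P) f - (Q * P) g) ∈ a.domain := hvw ▸ (v - w).2
  rw [show v - w = ⟨_, hmem⟩ from Subtype.ext hvw]
  exact h.form_apply_self_of_mem hB ha ⟨f - g, map_sub _ _ _⟩ hmem

omit [CompleteSpace H] in
theorem re_form_sub_le (ha : a.IsSectorial) (u v w : a.domain) :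
    (a.form (v - w) (v - w)).re ≤
      2 * ((a.form (v - u) (v - u)).re + (a.form (w - u) (w - u)).re) := by
  obtain ⟨α, -, -, hsec⟩ := ha
  have h1 := congrArg Complex.re (form_parallelogram a.form (v - u) (w - u))
  have h2 := (hsec (v - u + (w - u))).1
  have r2 : ∀ z : ℂ, (2 * z).re = 2 * z.re := fun z => by simp
  rw [sub_sub_sub_cancel_right, Complex.add_re, r2, Complex.add_re] at h1
  linarith

omit [CompleteSpace H] in
theorem tendsto_re_form_sub (ha : a.IsSectorial) {v : ℕ → a.domain} {u : a.domain}
    (hv : Tendsto (fun n => a.form (v n - u) (v n - u)) atTop (𝓝 0)) :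
    Tendsto (fun p : ℕ × ℕ => (a.form (v p.1 - v p.2) (v p.1 - v p.2)).re) atTop (𝓝 0) := by
  have hre := (Complex.continuous_re.tendsto _).comp hv
  rw [Complex.zero_re] at hre
  set g : ℕ → ℝ := Complex.re ∘ fun n => a.form (v n - u) (v n - u)
  have h2 : Tendsto (fun p : ℕ × ℕ => 2 * (g p.1 + g p.2)) atTop (𝓝 0) := by
    rw [← prod_atTop_atTop_eq]
    have h3 := ((hre.comp tendsto_fst).add (hre.comp tendsto_snd)).const_mul 2
    rw [add_zero, mul_zero] at h3
    exact h3
  refine squeeze_zero (fun p => ?_) (fun p => re_form_sub_le ha u _ _) h2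
  obtain ⟨α, -, -, hsec⟩ := ha
  exact (hsec _).1

/-- The core property approximates u by vectors PQPfₙ of dom B; coercivity of Q⁻¹ makes QPfₙ
converge, so the domain is contained in ran P. -/
theorem exists_tendsto_of_domain (h : SectorialFactor K P Q) (hB : IsBoundedInverse B K)
    (ha : a.IsAssociated B) (u : a.domain) :
    ∃ (f : ℕ → H) (v : ℕ → a.domain) (x : H), (∀ n, (v n : H) = P ((Q * P) (f n))) ∧
      Tendsto (fun n => (Q * P) (f n)) atTop (𝓝 x) ∧ (u : H) = P x ∧
      Tendsto (fun n => a.form (v n - u) (v n - u)) atTop (𝓝 0) := by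
  obtain ⟨v, hv, hvu, hform⟩ := ha.2.2.2 u
  have hf : ∀ n, ∃ f, (v n : H) = P ((Q * P) f) := fun n => by
    have := hv n
    rw [hB.domain_eq] at this
    obtain ⟨f, hf⟩ := this
    exact ⟨f, by rw [← h.apply_eq]; exact hf.symm⟩
  choose f hf using hf
  have hlim : Tendsto (fun p : ℕ × ℕ => (inner ℂ ((Q * P) (f p.1) - (Q * P) (f p.2))
      (Ring.inverse Q ((Q * P) (f p.1) - (Q * P) (f p.2)))).re) atTop (𝓝 0) :=
    (tendsto_re_form_sub ha.1 hform).congr fun p =>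
      congrArg Complex.re (h.form_sub_apply_self hB ha (hf p.1) (hf p.2))
  obtain ⟨x, hx⟩ := h.exists_tendsto (x := fun n => (Q * P) (f n)) hlim
  have hux : Tendsto (fun n => (v n : H)) atTop (𝓝 (P x)) :=
    ((P.continuous.tendsto x).comp hx).congr fun n => (hf n).symm
  exact ⟨f, v, x, hf, hx, tendsto_nhds_unique hvu hux, hform⟩

/-- The formula holds for Px in dom B; the sectorial Cauchy–Schwarz inequality lets the first
argument pass to the limit. -/
theorem form_apply (h : SectorialFactor K P Q) (hB : IsBoundedInverse B K)
    (ha : a.IsAssociated B) (x y : H) (hx : P x ∈ a.domain) (hy : P y ∈ a.domain) :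
    a.form ⟨P x, hx⟩ ⟨P y, hy⟩ = inner ℂ y (Ring.inverse Q x) := by
  obtain ⟨f, w, x', hw, hlim, hxx', hform⟩ := h.exists_tendsto_of_domain hB ha ⟨P x, hx⟩
  obtain rfl : x = x' := eq_of_apply_eq h.injective hxx'
  obtain ⟨α, -, -, hsec⟩ := ha.1
  set u : a.domain := ⟨P x, hx⟩
  set v : a.domain := ⟨P y, hy⟩
  have h1 : Tendsto (fun n => a.form (w n) v) atTop (𝓝 (inner ℂ y (Ring.inverse Q x))) := by
    have : ∀ n, a.form (w n) v = inner ℂ y (Ring.inverse Q ((Q * P) (f n))) := fun n => by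
      obtain ⟨hd, hv⟩ := h.form_apply_of_mem hB ha (f n)
      rw [← h.inner_apply, show w n = ⟨_, hd⟩ from Subtype.ext (hw n)]
      exact hv v
    simp only [this]
    have hc : Continuous fun z : H => inner ℂ y (Ring.inverse Q z) := by fun_prop
    exact (hc.tendsto x).comp hlim
  refine tendsto_nhds_unique ?_ h1
  rw [← tendsto_sub_nhds_zero_iff]
  have h2 : Tendsto (fun n => (2 * (1 + Real.tan α)) ^ 2 * ((a.form (w n - u) (w n - u)).re *
      (a.form v v).re)) atTop (𝓝 0) := by
    have := ((((Complex.continuous_re.tendsto _).comp hform).mul_const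
      (a.form v v).re).const_mul ((2 * (1 + Real.tan α)) ^ 2))
    rw [Complex.zero_re, zero_mul, mul_zero] at this
    exact this
  have h3 : Tendsto (fun n => ‖a.form (w n - u) v‖ ^ 2) atTop (𝓝 0) :=
    squeeze_zero (fun n => sq_nonneg _) (fun n => norm_form_sq_le hsec _ _) h2
  have h4 : Tendsto (fun n => ‖a.form (w n - u) v‖) atTop (𝓝 0) := by
    have := (Real.continuous_sqrt.tendsto _).comp h3
    simpa [Function.comp_def, Real.sqrt_sq] using this
  rw [tendsto_zero_iff_norm_tendsto_zero]
  simpa [map_sub] using h4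

end Associated

/-- The inverse `P (Re Q⁻¹)⁻¹ P` of the real part of the operator with inverse `P Q P`. -/
theorem isBoundedInverse_realPartOp (h : SectorialFactor K P Q) {B : H →ₗ.[ℂ] H}
    (hB : IsBoundedInverse B K) :
    IsBoundedInverse (realPartOp B) (P * (Ring.inverse (reOp (Ring.inverse Q)) * P)) := by
  -- Existence rules out the default value in `formOf`. The chosen form is known only to be
  -- associated with B, hence the uniqueness results above.
  have hex : ∃ a : SesqForm H, a.IsAssociated B := ⟨_, h.toForm_isAssociated hB⟩
  obtain ⟨a, ha, hop⟩ : ∃ a : SesqForm H, a.IsAssociated B ∧ realPartOp B = a.realPart.operator :=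
    ⟨_, hex.choose_spec, by rw [realPartOp, formOf, dif_pos hex]⟩
  obtain ⟨c, hc, hle⟩ := h.exists_re_inner_ge
  have hE : IsUnit (reOp (Ring.inverse Q)) := isUnit_of_coercive hc fun x => by
    rw [inner_reOp_self, Complex.ofReal_re]; exact hle x
  have hform : ∀ (x y : H) (hx : P x ∈ a.domain) (hy : P y ∈ a.domain),
      a.realPart.form ⟨P x, hx⟩ ⟨P y, hy⟩ = inner ℂ y (reOp (Ring.inverse Q) x) := by
    intro x y hx hy
    change (1 / 2 : ℂ) * (a.form ⟨P x, hx⟩ ⟨P y, hy⟩ +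
      starRingEnd ℂ (a.form ⟨P y, hy⟩ ⟨P x, hx⟩)) = _
    rw [h.form_apply hB ha, h.form_apply hB ha, inner_conj_symm, reOp, smul_apply, add_apply,
      inner_smul_right, inner_add_right, ← ContinuousLinearMap.star_eq_adjoint, inner_star_apply]
  have hgraph : ∀ u w, (u, w) ∈ a.realPart.operatorGraph ↔
      (P * (Ring.inverse (reOp (Ring.inverse Q)) * P)) w = u := by
    intro u w
    -- The weak equation for u = Px reads (Re Q⁻¹)x = Pw.
    have hx0 : ∀ x, (∀ y, inner ℂ y (reOp (Ring.inverse Q) x) = inner ℂ (P y) w) ↔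
        Ring.inverse (reOp (Ring.inverse Q)) (P w) = x := fun x => by
      have h1 : ∀ y, inner ℂ (P y) w = inner ℂ y (P w) := fun y => by
        rw [← star_inner_apply, h.star_eq]
      simp only [h1]
      constructor
      · intro hy
        rw [← ext_inner_left ℂ hy, ← mul_apply_eq_comp, Ring.inverse_mul_cancel _ hE,
          one_apply_eq_self]
      · rintro rfl y
        rw [← mul_apply_eq_comp (reOp _), Ring.mul_inverse_cancel _ hE, one_apply_eq_self]
    simp only [mul_apply_eq_comp]
    constructor
    · rintro ⟨v, hv, hform'⟩
      obtain ⟨-, -, x, -, -, hx, -⟩ := h.exists_tendsto_of_domain hB ha v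
      obtain ⟨v, hvd⟩ := v
      simp only at hv hx
      subst hx
      rw [← hv, (hx0 x).mp fun y => ?_]
      rw [← hform x y hvd (h.mem_domain hB ha y)]
      exact hform' ⟨P y, h.mem_domain hB ha y⟩
    · intro hu
      subst hu
      refine ⟨⟨_, h.mem_domain hB ha _⟩, rfl, ?_⟩
      rintro ⟨v, hvd⟩
      obtain ⟨-, -, y, -, -, hy, -⟩ := h.exists_tendsto_of_domain hB ha ⟨v, hvd⟩
      simp only at hy
      subst hy
      exact (hform _ y _ hvd).trans ((hx0 _).mpr rfl y)
  refine isBoundedInverse_iff.mpr fun u w => ?_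
  rw [hop, SesqForm.operator, Submodule.toLinearPMap_graph_eq, hgraph]
  -- The operator graph must be single-valued for `toLinearPMap` to have it as its graph.
  rintro ⟨u, w⟩ hw hu
  simp only at hu
  rw [hgraph, hu, mul_apply_eq_comp, mul_apply_eq_comp] at hw
  have h1 := h.injective _ hw
  refine h.injective w ?_
  rw [← one_apply_eq_self (F := H →L[ℂ] H) (P w), ← Ring.mul_inverse_cancel _ hE,
    mul_apply_eq_comp, h1, map_zero]

/-- With F = (Re Q⁻¹)⁻¹ and L = PFP = B_R⁻¹ one has ‖L^(1/2)f‖² = (FPf, Pf), which lies between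
multiples of ‖Pf‖²; both operators are selfadjoint, so their ranges agree. -/
theorem sqrtOp_realPartOp_domain (h : SectorialFactor K P Q) {B : H →ₗ.[ℂ] H}
    (hB : IsBoundedInverse B K) : (sqrtOp (realPartOp B)).domain = P.range := by
  have hL := h.isBoundedInverse_realPartOp hB
  obtain ⟨c, hc, hle⟩ := h.exists_re_inner_ge
  set E := reOp (Ring.inverse Q)
  have hEle : ∀ x, c * ‖x‖ ^ 2 ≤ (inner ℂ x (E x)).re := fun x => by
    rw [inner_reOp_self, Complex.ofReal_re]; exact hle x
  obtain ⟨d, hd, hdle⟩ := exists_re_inner_inverse_ge hc hEle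
  set F := Ring.inverse E
  set L := P * (F * P)
  have hLF : ∀ f, (inner ℂ f (L f)).re = (inner ℂ (P f) (F (P f))).re := fun f => by
    rw [mul_apply_eq_comp, mul_apply_eq_comp, ← star_inner_apply, h.star_eq]
  have hLs : star L = L := by
    rw [star_mul, star_mul, h.star_eq, ← Ring.inverse_star, star_reOp, mul_assoc]
  have hLa : IsBoundedAccretive L := fun f => by
    rw [hLF]
    exact le_trans (by positivity) (hdle (P f))
  have hS := hL.sqrtOp hLa
  have hSs : star (accretiveSqrt L) = accretiveSqrt L := by rw [hLa.star_accretiveSqrt, hLs]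
  have hSn : ∀ f, ‖accretiveSqrt L f‖ ^ 2 = (inner ℂ (P f) (F (P f))).re := fun f => by
    rw [← hLF]
    nth_rw 2 [← hLa.accretiveSqrt_mul_self]
    rw [mul_apply_eq_comp, ← star_inner_apply, hSs, inner_self_eq_norm_sq_to_K]
    norm_cast
  rw [hS.domain_eq]
  refine le_antisymm (range_le_of_norm_star_le h.injective (c := √‖F‖) (Real.sqrt_nonneg _)
    fun f => ?_) (range_le_of_norm_star_le (fun x hx => hS.eq_zero hx) (c := √d⁻¹)
      (Real.sqrt_nonneg _) fun f => ?_)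
  · rw [hSs, h.star_eq]
    refine le_of_sq_le_sq ?_ (by positivity)
    rw [hSn, mul_pow, Real.sq_sqrt (norm_nonneg _)]
    calc (inner ℂ (P f) (F (P f))).re ≤ ‖inner ℂ (P f) (F (P f))‖ := Complex.re_le_norm _
      _ ≤ ‖P f‖ * ‖F (P f)‖ := norm_inner_le_norm _ _
      _ ≤ ‖P f‖ * (‖F‖ * ‖P f‖) := by gcongr; exact F.le_opNorm _
      _ = _ := by ring
  · rw [hSs, h.star_eq]
    refine le_of_sq_le_sq ?_ (by positivity)
    rw [mul_pow, Real.sq_sqrt (by positivity), le_inv_mul_iff₀ hd, hSn]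
    exact hdle (P f)

end SectorialFactor

theorem isReSqrt_sqrt {K : H →L[ℂ] H} (hK : IsBoundedAccretive K) :
    IsReSqrt K (CFC.sqrt (reOp K)) := by
  have h : 0 ≤ reOp K := by
    rw [ContinuousLinearMap.nonneg_iff_isPositive, ContinuousLinearMap.isPositive_iff_complex]
    intro f
    rw [← inner_conj_symm, inner_reOp_self, Complex.conj_ofReal]
    exact ⟨by simp, by simpa using hK f⟩
  exact ⟨(CFC.sqrt_nonneg _).isSelfAdjoint, CFC.sqrt_mul_sqrt_self _ h⟩

omit [CompleteSpace H] in
theorem IsBoundedInverse.isBoundedSectorial {B : H →ₗ.[ℂ] H} {K : H →L[ℂ] H}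
    (h : IsBoundedInverse B K) {k : ℝ}
    (hB : ∀ u : B.domain, |(inner ℂ (u : H) (B u)).im| ≤ k * (inner ℂ (u : H) (B u)).re) :
    IsBoundedSectorial K k := fun f => by
  obtain ⟨u, hu, hf⟩ := (LinearPMap.mem_graph_iff _).mp (h.1 f)
  have := hB u
  simp only at hu hf
  rw [hu, hf, ← inner_conj_symm, Complex.conj_re, Complex.conj_im, abs_neg] at this
  exact this

end

end KatoSquareRoot

end

open KatoSquareRoot

/-! ### Translation of the theorem into statements about S, W and P -/

theorem mainTheorem1 {H : Type*} [NormedAddCommGroup H] [InnerProductSpace ℂ H] [CompleteSpace H]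
    (B : H →ₗ.[ℂ] H) (hB : IsMAccretive B) (hunb : ¬ IsBoundedOp B)
    (hinv : HasBoundedInverse B) :
    List.TFAE [
      (sqrtOp B).domain = (sqrtOp B.adjoint).domain,
      IsBoundedOp (opMul (sqrtOp B) (ofBounded (invSqrt B.adjoint))) ∧
        HasBoundedInverse (opMul (sqrtOp B) (ofBounded (invSqrt B.adjoint))),
      ran (idOp + opZ B) = ⊤ ∧ ran (idOp - opZ B) = ⊤,
      ran (idOp - opMul (opZ B) (opZ B)) = ⊤,
      (ofBounded (reOp (invSqrt B))).inverse.domain ≤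
        (sqrtOp B).domain ⊓ (sqrtOp B.adjoint).domain] ∧
    (IsMSectorial B → List.TFAE [
      (sqrtOp B).domain = (sqrtOp B.adjoint).domain,
      (sqrtOp B).domain = (sqrtOp (realPartOp B)).domain,
      (sqrtOp B.adjoint).domain = (sqrtOp (realPartOp B)).domain,
      (sqrtOp B).domain ≤ (sqrtOp (realPartOp B)).domain ∧
        (sqrtOp B.adjoint).domain ≤ (sqrtOp (realPartOp B)).domain,
      (sqrtOp (realPartOp B)).domain ≤ (sqrtOp B).domain ⊓ (sqrtOp B.adjoint).domain,
      opNorm (opZ B) < 1,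
      BddAbove (Set.range fun f : {f : H // f ≠ 0} =>
        ‖reOp (invSqrt B) f‖ ^ 2 / (inner ℂ (f : H) (boundedInv B f)).re),
      BddAbove (Set.range fun f : {f : H // f ≠ 0} =>
        (‖invSqrt B.adjoint f‖ ^ 2 + ‖invSqrt B f‖ ^ 2) /
          (inner ℂ (f : H) (boundedInv B f)).re),
      (ofBounded (reOp (invSqrt B))).inverse.domain =
        (ofBounded (CFC.sqrt (reOp (boundedInv B)))).inverse.domain]) := by
  obtain ⟨K, hK⟩ := hinv
  have hKa := hK.isBoundedAccretive hB.1
  have hS := hK.sqrtOp hKa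
  have hS' := (hK.adjoint hB.2.1).sqrtOp hKa.star
  rw [← hKa.star_accretiveSqrt] at hS'
  have hS2 := hKa.accretiveSqrt_mul_self
  set S := accretiveSqrt K
  have hinj : ∀ x, S x = 0 → x = 0 := fun x => hS.eq_zero
  have hinj' : ∀ x, star S x = 0 → x = 0 := fun x => hS'.eq_zero
  have hiS : invSqrt B = S := hS.boundedInv_eq
  have hiS' : invSqrt B.adjoint = star S := hS'.boundedInv_eq
  obtain ⟨W, hW⟩ := exists_imFactor hinj (by rwa [hS2])
  have hid : (idOp : H →ₗ.[ℂ] H) = ofBounded 1 := rfl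
  rw [opZ_eq (by rwa [hiS]), hS.domain_eq, hS'.domain_eq, hiS, hiS', hid, ofBounded_add,
    ofBounded_mul, ofBounded_sub, ofBounded_sub, ran_ofBounded, ran_ofBounded, ran_ofBounded,
    inverse_ofBounded_domain]
  refine ⟨tfae_range_eq hS hinj' hW, fun hsec => ?_⟩
  obtain ⟨-, α, hα0, hα, hsec⟩ := hsec
  have hk : 0 ≤ Real.tan α := Real.tan_nonneg_of_nonneg_of_le_pi_div_two hα0 hα.le
  have hKs := hK.isBoundedSectorial hsec
  have hP := isReSqrt_sqrt hKa
  obtain ⟨Q, hQ⟩ := hP.exists_sectorialFactor hk hKs fun x => hK.eq_zero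
  rw [hQ.sqrtOp_realPartOp_domain hK, hK.boundedInv_eq, inverse_ofBounded_domain,
    opNorm_ofBounded, enorm_smul, ← ofReal_norm, ← ofReal_norm (star W), Complex.norm_I,
    ENNReal.ofReal_one, one_mul, ENNReal.ofReal_lt_one, norm_star]
  simp only [← hS2] at hP hKs ⊢
  exact tfae_range_eq_of_sectorial hW hinj hinj' hP hk hKs
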